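/- **Setting.** Let $N\ge 1$, let $\mathcal X,\Theta$ be measurable spaces, $\mathcal Y$ a finite set with the discrete $\sigma$-algebra, and let $(\theta,x)\mapsto f_\theta(x)\in\mathcal Y$ be measurable on $\Theta\times\mathcal X$. Let $P_1,\dots,P_N$ be probability measures on $\mathcal X\times\mathcal Y$, $\mathbb P=\bigotimes_{i=1}^N P_i$, and let $(X_i,Y_i)_{i=1}^N$ be the coordinate process on $(\mathcal X\times\mathcal Y)^N$. Put $\sigma_i(\theta)=\mathbf 1[f_\theta(X_i)\ne Y_i]$ and $$R(\theta)=\frac1N\sum_{i=1}^N\mathbb P[\sigma_i(\theta)=1],\qquad r(\theta)=\frac1N\sum_{i=1}^N\sigma_i(\theta),$$ $$m'(\theta,\theta')=\frac1N\sum_{i=1}^N(\sigma_i(\theta)-\sigma_i(\theta'))^2,\qquad M'(\theta,\theta')=\mathbb P[m'(\theta,\theta')].$$ Assume that some $\tilde\theta\in\Theta$ satisfies $R(\tilde\theta)=\inf_\Theta R$, and let $$\varphi(x)=\sup_{\theta\in\Theta}\bigl(M'(\theta,\tilde\theta)-x[R(\theta)-R(\tilde\theta)]\bigr),\qquad x\ge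 0,$$ be the margin function. For a probability measure $\rho$ on $\Theta$ and a function $h$ write $\rho(h)=\int h\,d\rho$; $\rho(m')$ is the function $\theta\mapsto\int m'(\theta,\theta')\,\rho(d\theta')$. For a probability measure $\pi$ on $\Theta$ and bounded measurable $h$, $\pi_{\exp(h)}$ is the probability measure with density $e^{h}/\pi(e^{h})$ with respect to $\pi$. $\mathcal K$ is the Kullback divergence. For $\alpha>1$ let $\Lambda_\alpha=\{\alpha^k:k\in\mathbb N,\ 0\le k<\log N/\log\alpha\}$, and let $\nu$ be the uniform probability measure on $\Lambda_\alpha$. For $\gamma>0$ let $F_{\gamma,a}(x)=-N\log[1-\tanh(\tfrac\gamma N)x]-ax$; for $a<N\tanh(\tfrac{\gamma}{N})$ and $y\ge 0$, $F_{\gamma,a}^{-1}(y)$ is the unique $x\in[0,\tanh(\tfrac\gamma N)^{-1})$ with $F_{\gamma,a}(x)=y$. Put $$L_\gamma(\lambda,\rho)=\log\Bigl\{\pi_{\exp(-\lambda r)}\bigl[\exp\{N\log[\cosh(\tfrac\gamma N)]\,\rho(m')\}\bigr]\Bigr\}.$$ For $\beta,\gamma\in\Lambda_\alpha$ and $\epsilon\in(0,1]$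 define the empirical bound $$B(\rho,\beta,\gamma)=\inf_{\substack{0\le\lambda_1\le\gamma\\ \lambda_2>\frac{\beta\gamma}{N}\tanh(\frac\gamma N)^{-1}}}\Bigl\{\mathcal K[\rho,\pi_{\exp(-\lambda_1r)}]+(\gamma-\lambda_1)\bigl[\rho(r)-\pi_{\exp(-\lambda_2r)}(r)\bigr]+L_\gamma(\lambda_1,\rho)-\log[\epsilon\,\nu(\{\beta\})\nu(\{\gamma\})]$$ $$\qquad+(\gamma-\lambda_1)\tfrac{\beta}{\lambda_2}F^{-1}_{\gamma,\frac{\beta\gamma}{\lambda_2}}\Bigl(L_\gamma(\lambda_2,\pi_{\exp(-\lambda_2r)})-\log[\epsilon\,\nu(\{\beta\})\nu(\{\gamma\})]\Bigr)\Bigr\},$$ and $B(\rho,\beta,\gamma)=+\infty$ if $\beta\notin\Lambda_\alpha$ or $\gamma\notin\Lambda_\alpha$. Finally let $$\hat\beta(\rho)=\sup\Bigl\{\beta\in\mathbb R:\ \inf_{\gamma:\,N\tanh(\gamma/N)>\beta}B(\rho,\beta,\gamma)\le 0\Bigr\}.$$ **Theorem.** There exist universal positive real constants $A,B_1,B_2,B_3,B_4$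 such that in every setting as above, for all real $\alpha\in(1,N]$, $d>0$, $\delta\in(0,1)$, $\epsilon\in(0,1]$ and every probability measure $\pi$ on $\Theta$, with $\mathbb P$-probability at least $1-\epsilon$ the following holds simultaneously for all $\beta,\gamma\in\Lambda_\alpha$ such that $$\sup_{\beta'\ge\beta}\Bigl|\frac{\beta'}{d}\bigl[\pi_{\exp(-\beta'R)}(R)-\inf_\Theta R\bigr]-1\Bigr|\le\delta$$ and such that for some real $x>0$ $$\frac{\gamma\max\{x,1\}}{N}\le\frac{A\beta}{\gamma}\quad\text{and}\quad\frac\beta\gamma\le\frac{B_1}{B_2\frac{1+\delta}{1-\delta}+\dfrac{B_4\frac{\gamma^2}{N}\varphi(x)-2B_3\log(\epsilon)+4B_3\log\bigl[\frac{\log N}{\log\alpha}\bigr]}{(1-\delta)d}}:$$ one has $B(\pi_{\exp(-\frac\gamma2r)},\beta,\gamma)\le0$, $\ \hat\beta(\pi_{\exp(-\frac\gamma2r)})\ge\beta$, and $$\pi_{\exp(-\frac\gamma2r)}(R)\le\pi_{\exp(-\beta R)}(R)\le\inf_\Theta R+\frac{(1+\delta)d}{\beta}.$$ -/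

import Mathlib

open MeasureTheory

noncomputable section

namespace PACBayes

/-- The indicator `𝟙[f_θ(x) ≠ y]` of a classification error on the labelled pattern `z = (x, y)`. -/
def err {X Y Θ : Type*} (f : Θ → X → Y) (θ : Θ) (z : X × Y) : ℝ :=
  Set.indicator {z : X × Y | f θ z.1 ≠ z.2} (fun _ => (1 : ℝ)) z

/-- The expected error rate `R(θ) = (1/N) ∑ᵢ ℙ[f_θ(Xᵢ) ≠ Yᵢ]`, where `(Xᵢ, Yᵢ)` has law `P i`. -/
def risk {X Y Θ : Type*} [MeasurableSpace X] [MeasurableSpace Y] {N : ℕ}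
    (P : Fin N → Measure (X × Y)) (f : Θ → X → Y) (θ : Θ) : ℝ :=
  (1 / (N : ℝ)) * ∑ i, (P i).real {z : X × Y | f θ z.1 ≠ z.2}

/-- The empirical error rate `r(θ, ω) = (1/N) ∑ᵢ 𝟙[f_θ(Xᵢ) ≠ Yᵢ]` on the sample `ω`. -/
def empRisk {X Y Θ : Type*} {N : ℕ} (f : Θ → X → Y) (ω : Fin N → X × Y) (θ : Θ) : ℝ :=
  (1 / (N : ℝ)) * ∑ i, err f θ (ω i)

/-- The expected pseudo-distance
`M'(θ, θ') = (1/N) ∑ᵢ ℙ[(𝟙[f_θ(Xᵢ) ≠ Yᵢ] - 𝟙[f_θ'(Xᵢ) ≠ Yᵢ])²]`. -/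
def expDist {X Y Θ : Type*} [MeasurableSpace X] [MeasurableSpace Y] {N : ℕ}
    (P : Fin N → Measure (X × Y)) (f : Θ → X → Y) (θ θ' : Θ) : ℝ :=
  (1 / (N : ℝ)) * ∑ i, ∫ z, (err f θ z - err f θ' z) ^ 2 ∂(P i)

/-- The empirical pseudo-distance
`m'(θ, θ') = (1/N) ∑ᵢ (𝟙[f_θ(Xᵢ) ≠ Yᵢ] - 𝟙[f_θ'(Xᵢ) ≠ Yᵢ])²`. -/
def empDist {X Y Θ : Type*} {N : ℕ} (f : Θ → X → Y) (ω : Fin N → X × Y) (θ θ' : Θ) : ℝ :=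
  (1 / (N : ℝ)) * ∑ i, (err f θ (ω i) - err f θ' (ω i)) ^ 2

/-- The margin function `φ(x) = sup_θ (M'(θ, θ̃) - x (R(θ) - R(θ̃)))`. -/
def margin {X Y Θ : Type*} [MeasurableSpace X] [MeasurableSpace Y] {N : ℕ}
    (P : Fin N → Measure (X × Y)) (f : Θ → X → Y) (θt : Θ) (x : ℝ) : ℝ :=
  ⨆ θ, (expDist P f θ θt - x * (risk P f θ - risk P f θt))

/-- The Gibbs distribution `π_{exp(-b h)}`, of density `exp(-b h) / π[exp(-b h)]` with respect to
`π`. -/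
def gibbs {Θ : Type*} [MeasurableSpace Θ] (π : Measure Θ) (b : ℝ) (h : Θ → ℝ) : Measure Θ :=
  π.tilted (fun θ => -(b * h θ))

/-- `F_{γ,a}(x) = -N log(1 - tanh(γ/N) x) - a x`, for `tanh(γ/N) x < 1`. -/
def FF (N : ℕ) (γ a x : ℝ) : ℝ :=
  -(N : ℝ) * Real.log (1 - Real.tanh (γ / N) * x) - a * x

/-- The inverse of `F_{γ,a}`: the largest `x` in the domain of `F_{γ,a}` with `F_{γ,a}(x) ≤ y`.
For `γ > 0` and `a < N tanh(γ/N)` the function `F_{γ,a}` is an increasing bijection from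
`[0, 1/tanh(γ/N))` onto `[0, ∞)`, and for `y ≥ 0` this is its inverse at `y`. -/
def FFinv (N : ℕ) (γ a y : ℝ) : ℝ :=
  sSup {x : ℝ | Real.tanh (γ / N) * x < 1 ∧ FF N γ a x ≤ y}

/-- `log π_{exp(-b r)}[exp{N log[cosh(γ/N)] ρ(m')}]`, where `ρ(m')` is the function
`θ ↦ ∫ m'(θ, θ') ρ(dθ')`. -/
def logLaplace {X Y Θ : Type*} [MeasurableSpace Θ] {N : ℕ} (f : Θ → X → Y) (π : Measure Θ)
    (ω : Fin N → X × Y) (γ b : ℝ) (ρ : Measure Θ) : ℝ :=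
  Real.log (∫ θ, Real.exp ((N : ℝ) * Real.log (Real.cosh (γ / N)) * ∫ θ', empDist f ω θ θ' ∂ρ)
    ∂(gibbs π b (empRisk f ω)))

open Classical in
/-- The empirical bound `B(ρ, β, γ)` at the sample `ω`, for the atomic measure `ν` and the
confidence level `ε`. It is an infimum over `l₁ ∈ [0, γ]` and `l₂ > (βγ/N) tanh(γ/N)⁻¹`. Because of
the terms `-log[ε ν({β}) ν({γ})]` its value is `+∞` when `ν({β}) = 0` or `ν({γ}) = 0`. -/
def bound {X Y Θ : Type*} [MeasurableSpace Θ] {N : ℕ} (f : Θ → X → Y) (π : Measure Θ)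
    (ν : Measure ℝ) (ε : ℝ) (ω : Fin N → X × Y) (ρ : Measure Θ) (β γ : ℝ) : EReal :=
  if ν {β} = 0 ∨ ν {γ} = 0 then ⊤ else
    ⨅ (l₁ : ℝ) (l₂ : ℝ)
      (_ : 0 ≤ l₁ ∧ l₁ ≤ γ ∧ β * γ / N * (Real.tanh (γ / N))⁻¹ < l₂),
      ((InformationTheory.klDiv ρ (gibbs π l₁ (empRisk f ω)) : ENNReal) : EReal) +
      (((γ - l₁) * (∫ θ, empRisk f ω θ ∂ρ
            - ∫ θ, empRisk f ω θ ∂(gibbs π l₂ (empRisk f ω)))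
        + logLaplace f π ω γ l₁ ρ
        - Real.log (ε * ν.real {β} * ν.real {γ})
        + (γ - l₁) * (β / l₂) * FFinv N γ (β * γ / l₂)
            (logLaplace f π ω γ l₂ (gibbs π l₂ (empRisk f ω))
              - Real.log (ε * ν.real {β} * ν.real {γ})) : ℝ) : EReal)

/-- `β̂(ρ) = sup {β ∈ ℝ; inf_{γ, N tanh(γ/N) > β} B(ρ, β, γ) ≤ 0}`, at the sample `ω`. -/
def betaHat {X Y Θ : Type*} [MeasurableSpace Θ] {N : ℕ} (f : Θ → X → Y) (π : Measure Θ)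
    (ν : Measure ℝ) (ε : ℝ) (ω : Fin N → X × Y) (ρ : Measure Θ) : EReal :=
  ⨆ (β : ℝ) (_ : (⨅ (γ : ℝ) (_ : β < N * Real.tanh (γ / N)), bound f π ν ε ω ρ β γ) ≤ 0),
    (β : EReal)

/-- The grid `Λ_α = {α^k ; k ∈ ℕ, 0 ≤ k < log N / log α}`. -/
def grid (N : ℕ) (α : ℝ) : Set ℝ :=
  {b : ℝ | ∃ k : ℕ, (k : ℝ) < Real.log N / Real.log α ∧ b = α ^ k}

end PACBayes

end

/-! Test the bound at `l₁ = γ/2` and `l₂ = 4β`. The posterior is then its own reference, so the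
divergence vanishes. What remains is that γ/2 times the drop in empirical risk between inverse
temperatures 4β and γ/2 exceeds the two log-Laplace terms and the confidence cost.

Put u = R − R(θ̃) and v = r − r(θ̃). The dimension hypothesis pins b·E[u] between p = (1−δ)d and q =
(1+δ)d under every deterministic Gibbs measure of energy u with b ≥ β. `gibbs_comparison` transfers
this to the random Gibbs measure of energy v. Its divergence K from the deterministic one is at most
b times a difference of two expectations of v − u. Exponential moments at the larger scale γ control
both, one of them at the cost of K itself. As b ≤ γ/2, that K is absorbed and γK is of order b(q +
D), with D the deviation level. At b = 4β this is negligible against p, so E[u] there stays of order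
p/β. At b = γ/2 the mean of u is only of order (q + D)/γ. The smallness of β/γ separates the two
scales, and `bound_expression_nonpos` does the accounting.

The exponential moments come from `integral_exp_deviation_le` (independence, second order
expansion). They are averaged over deterministic Gibbs measures and made simultaneous over the grid
by Markov's inequality in `exists_event_grid`. Their variance term M' is at most x·u + φ(x), and the
condition on γ²x/N lets β·u absorb the first summand (`logMgf_le_of_deviation`). -/

namespace PACBayes

/-- Bounded measurable real functions. -/
def BddMeas {Θ : Type*} [MeasurableSpace Θ] (h : Θ → ℝ) : Prop :=
  Measurable h ∧ ∃ C, ∀ θ, |h θ| ≤ C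

/-- The log-Laplace functional `log Q[exp h]`. -/
noncomputable def logMgf {Θ : Type*} [MeasurableSpace Θ] (Q : Measure Θ) (h : Θ → ℝ) : ℝ :=
  Real.log (∫ θ, Real.exp (h θ) ∂Q)

/-! ### Log-Laplace transforms and Gibbs measures. -/

section Tools

variable {Θ : Type*} [MeasurableSpace Θ] {g h u v : Θ → ℝ} {Q : Measure Θ}

theorem BddMeas.const (c : ℝ) : BddMeas (fun _ : Θ => c) :=
  ⟨measurable_const, |c|, fun _ => le_rfl⟩

theorem BddMeas.add (hg : BddMeas g) (hh : BddMeas h) : BddMeas (fun θ => g θ + h θ) := by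
  obtain ⟨mg, C, hC⟩ := hg
  obtain ⟨mh, D, hD⟩ := hh
  exact ⟨mg.add mh, C + D, fun θ => (abs_add_le _ _).trans (add_le_add (hC θ) (hD θ))⟩

theorem BddMeas.const_mul (hg : BddMeas g) (c : ℝ) : BddMeas (fun θ => c * g θ) := by
  obtain ⟨mg, C, hC⟩ := hg
  refine ⟨mg.const_mul c, |c| * C, fun θ => ?_⟩
  rw [abs_mul]
  exact mul_le_mul_of_nonneg_left (hC θ) (abs_nonneg c)

theorem BddMeas.neg (hg : BddMeas g) : BddMeas (fun θ => -g θ) := by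
  simpa using hg.const_mul (-1)

theorem BddMeas.sub (hg : BddMeas g) (hh : BddMeas h) : BddMeas (fun θ => g θ - h θ) := by
  simpa [sub_eq_add_neg] using hg.add hh.neg

theorem BddMeas.exp (hg : BddMeas g) : BddMeas (fun θ => Real.exp (g θ)) := by
  obtain ⟨mg, C, hC⟩ := hg
  refine ⟨mg.exp, Real.exp C, fun θ => ?_⟩
  rw [Real.abs_exp]
  exact Real.exp_le_exp.2 ((le_abs_self _).trans (hC θ))

theorem BddMeas.integrable [IsFiniteMeasure Q] (hg : BddMeas g) : Integrable g Q := by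
  obtain ⟨mg, C, hC⟩ := hg
  exact Integrable.of_bound mg.aestronglyMeasurable C (Filter.Eventually.of_forall hC)

theorem BddMeas.integral_exp_pos [IsProbabilityMeasure Q] (hg : BddMeas g) :
    0 < ∫ θ, Real.exp (g θ) ∂Q :=
  _root_.MeasureTheory.integral_exp_pos hg.exp.integrable

theorem logMgf_mono [IsProbabilityMeasure Q] (hg : BddMeas g) (hh : BddMeas h)
    (hgh : ∀ θ, g θ ≤ h θ) : logMgf Q g ≤ logMgf Q h :=
  Real.log_le_log hg.integral_exp_pos
    (integral_mono hg.exp.integrable hh.exp.integrable fun θ => Real.exp_le_exp.2 (hgh θ))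

theorem logMgf_add_const [IsProbabilityMeasure Q] (hg : BddMeas g) (c : ℝ) :
    logMgf Q (fun θ => g θ + c) = logMgf Q g + c := by
  unfold logMgf
  simp_rw [Real.exp_add]
  rw [integral_mul_const, Real.log_mul hg.integral_exp_pos.ne' (Real.exp_pos c).ne', Real.log_exp]

theorem logMgf_zero [IsProbabilityMeasure Q] : logMgf Q (fun _ => 0) = 0 := by
  simp [logMgf]

/-- Jensen's inequality for the exponential function. -/
theorem integral_le_logMgf [IsProbabilityMeasure Q] (hg : BddMeas g) :
    ∫ θ, g θ ∂Q ≤ logMgf Q g := by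
  rw [logMgf, Real.le_log_iff_exp_le hg.integral_exp_pos]
  exact convexOn_exp.map_integral_le Real.continuous_exp.continuousOn isClosed_univ
    (by simp) hg.integrable hg.exp.integrable

theorem isProbabilityMeasure_gibbs [IsProbabilityMeasure Q] (hu : BddMeas u) (b : ℝ) :
    IsProbabilityMeasure (gibbs Q b u) :=
  isProbabilityMeasure_tilted (hu.const_mul b).neg.exp.integrable

/-- Normalisation cancels constants, so risks and excess risks define the same Gibbs measures. -/
theorem gibbs_sub_const (b c : ℝ) : gibbs Q b (fun θ => u θ - c) = gibbs Q b u := by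
  unfold gibbs Measure.tilted
  have h : ∀ θ, Real.exp (-(b * (u θ - c))) = Real.exp (-(b * u θ)) * Real.exp (b * c) := by
    intro θ
    rw [← Real.exp_add]
    ring_nf
  simp_rw [h]
  rw [integral_mul_const]
  simp_rw [mul_div_mul_right _ _ (Real.exp_pos (b * c)).ne']

theorem logMgf_gibbs [IsProbabilityMeasure Q] (hu : BddMeas u) (hh : BddMeas h) (b : ℝ) :
    logMgf (gibbs Q b u) h =
      logMgf Q (fun θ => -(b * u θ) + h θ) - logMgf Q (fun θ => -(b * u θ)) := by
  have e := integral_exp_tilted (μ := Q) (fun θ => -(b * u θ)) h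
  unfold logMgf gibbs
  rw [e, Real.log_div]
  · rfl
  · exact ((hu.const_mul b).neg.add hh).integral_exp_pos.ne'
  · exact (hu.const_mul b).neg.integral_exp_pos.ne'

/-- Convexity of the log-Laplace transform of `u`. -/
theorem logMgf_gibbs_mul_le [IsProbabilityMeasure Q] (hu : BddMeas u) (b s : ℝ) :
    logMgf (gibbs Q b u) (fun θ => s * u θ) ≤ s * ∫ θ, u θ ∂(gibbs Q (b - s) u) := by
  have := isProbabilityMeasure_gibbs (Q := Q) hu (b - s)
  have h1 := integral_le_logMgf (Q := gibbs Q (b - s) u) (hu.const_mul (-s))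
  rw [logMgf_gibbs hu (hu.const_mul _), integral_const_mul] at h1
  rw [logMgf_gibbs hu (hu.const_mul _)]
  have e1 : (fun θ => -((b - s) * u θ) + -s * u θ) = fun θ => -(b * u θ) := by
    funext θ; ring
  have e2 : (fun θ => -((b - s) * u θ)) = fun θ => -(b * u θ) + s * u θ := by
    funext θ; ring
  rw [e1, e2] at h1
  linarith

/-- The divergence of `π_{exp(-b v)}` from `π_{exp(-b u)}`. -/
noncomputable def gibbsDiv (Q : Measure Θ) (b : ℝ) (v u : Θ → ℝ) : ℝ :=
  ∫ θ, -(b * (v θ - u θ)) ∂(gibbs Q b v)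
    + (logMgf Q (fun θ => -(b * u θ)) - logMgf Q (fun θ => -(b * v θ)))

/-- The entropy duality inequality between two Gibbs distributions. -/
theorem integral_gibbs_le [IsProbabilityMeasure Q] (hu : BddMeas u) (hv : BddMeas v)
    (hh : BddMeas h) (b : ℝ) :
    ∫ θ, h θ ∂(gibbs Q b v) ≤ gibbsDiv Q b v u + logMgf (gibbs Q b u) h := by
  have := isProbabilityMeasure_gibbs (Q := Q) hv b
  have hk : BddMeas (fun θ => -(b * (v θ - u θ))) := ((hv.sub hu).const_mul b).neg
  have h1 := integral_le_logMgf (Q := gibbs Q b v) (hh.sub hk)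
  rw [integral_sub hh.integrable hk.integrable, logMgf_gibbs hv (hh.sub hk)] at h1
  rw [logMgf_gibbs hu hh, gibbsDiv]
  have e1 : (fun θ => -(b * v θ) + (h θ - -(b * (v θ - u θ)))) = fun θ => -(b * u θ) + h θ := by
    funext θ; ring
  rw [e1] at h1
  linarith

theorem gibbsDiv_nonneg [IsProbabilityMeasure Q] (hu : BddMeas u) (hv : BddMeas v) (b : ℝ) :
    0 ≤ gibbsDiv Q b v u := by
  have := isProbabilityMeasure_gibbs (Q := Q) hu b
  have h := integral_gibbs_le (Q := Q) hu hv (BddMeas.const 0) b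
  rw [logMgf_zero] at h
  simpa using h

/-- Jensen under the Gibbs measure of `u`. Combined with the definition of `gibbsDiv`, it bounds the
divergence by `b` times the difference of the means of `v - u` under the two Gibbs measures. -/
theorem logMgf_sub_logMgf_le [IsProbabilityMeasure Q] (hu : BddMeas u) (hv : BddMeas v) (b : ℝ) :
    logMgf Q (fun θ => -(b * u θ)) - logMgf Q (fun θ => -(b * v θ))
      ≤ b * (∫ θ, v θ ∂(gibbs Q b u) - ∫ θ, u θ ∂(gibbs Q b u)) := by
  have := isProbabilityMeasure_gibbs (Q := Q) hu b
  have hk : BddMeas (fun θ => -(b * (v θ - u θ))) := ((hv.sub hu).const_mul b).neg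
  have h1 := integral_le_logMgf (Q := gibbs Q b u) hk
  rw [integral_neg, integral_const_mul, integral_sub hv.integrable hu.integrable,
    logMgf_gibbs hu hk] at h1
  have e1 : (fun θ => -(b * u θ) + -(b * (v θ - u θ))) = fun θ => -(b * v θ) := by
    funext θ; ring
  rw [e1] at h1
  linarith

/-- Comparison of the Gibbs distributions of energies `v` and `u` at inverse temperature `b`, when
`v - u` is controlled at the larger inverse temperature `γ`. -/
theorem gibbs_comparison [IsProbabilityMeasure Q] {m : Θ → ℝ} (hu : BddMeas u) (hv : BddMeas v)
    (hm : BddMeas m) (hu0 : ∀ θ, 0 ≤ u θ) {β b γ p q D : ℝ} (hβ : 0 < β) (hb : 4 * β ≤ b)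
    (hbγ : 2 * b ≤ γ) (hD : 0 ≤ D) (hp0 : 0 ≤ p)
    (hp : ∀ b', β ≤ b' → p ≤ b' * ∫ θ, u θ ∂(gibbs Q b' u))
    (hq : ∀ b', β ≤ b' → b' * ∫ θ, u θ ∂(gibbs Q b' u) ≤ q)
    (E1 : logMgf (gibbs Q b u) (fun θ => -γ * (v θ - u θ) - β * u θ) ≤ D)
    (E2 : logMgf (gibbs Q b u) (fun θ => γ * (v θ - u θ) - β * u θ) ≤ D)
    (E3 : logMgf (gibbs Q (b / 2) u) (fun θ => -b * (v θ - u θ) + m θ - β * u θ) ≤ D) :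
    ∃ K, 0 ≤ K ∧ γ * K ≤ 4 * b * (q + 2 * D) ∧
      b * ∫ θ, u θ ∂(gibbs Q b v) ≤ 2 * K + 2 * q ∧
      p / 2 - K ≤ b * ∫ θ, u θ ∂(gibbs Q b v) ∧
      |γ * (∫ θ, v θ ∂(gibbs Q b v) - ∫ θ, u θ ∂(gibbs Q b v))|
        ≤ β * ∫ θ, u θ ∂(gibbs Q b v) + D + K ∧
      logMgf (gibbs Q b v) m ≤ 2 * q + 2 * D := by
  have hb0 : 0 < b := by linarith
  have hγ : 0 < γ := by linarith
  have hbβ : β ≤ b := by linarith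
  have := isProbabilityMeasure_gibbs (Q := Q) hu b
  have := isProbabilityMeasure_gibbs (Q := Q) hu (b / 2)
  have := isProbabilityMeasure_gibbs (Q := Q) hv b
  have hw := hv.sub hu
  have hK0 := gibbsDiv_nonneg (Q := Q) hu hv b
  -- Unfolding one side only gives an equation in which the divergence can later become an atom `K`.
  have hKdef : gibbsDiv Q b v u = gibbsDiv Q b v u := rfl
  nth_rewrite 2 [gibbsDiv] at hKdef
  have hJ := logMgf_sub_logMgf_le (Q := Q) hu hv b
  have d1 := integral_gibbs_le (Q := Q) hu hv ((hw.const_mul (-γ)).sub (hu.const_mul β)) b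
  have d2 := integral_gibbs_le (Q := Q) hu hv ((hw.const_mul γ).sub (hu.const_mul β)) b
  have d3 := integral_gibbs_le (Q := Q) hu hv (hu.const_mul (b / 2)) b
  have d4 := integral_gibbs_le (Q := Q) hu hv (hu.const_mul (-b)) b
  have d5 := (integral_le_logMgf (Q := gibbs Q b u)
    ((hw.const_mul γ).sub (hu.const_mul β))).trans E2
  have c1 := logMgf_gibbs_mul_le (Q := Q) hu b (b / 2)
  have c2 := logMgf_gibbs_mul_le (Q := Q) hu b (-b)
  rw [integral_sub (hw.const_mul _).integrable (hu.const_mul _).integrable, integral_const_mul,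
    integral_const_mul, integral_sub hv.integrable hu.integrable] at d1 d2 d5
  rw [integral_const_mul] at d3 d4
  rw [integral_neg, integral_const_mul, integral_sub hv.integrable hu.integrable] at hKdef
  -- The test functions `(b/2)u` and `-b u` move the inverse temperature `b` to `b/2` and `2b`;
  -- these are where the bounds by `q` and `p` are needed.
  have p2 := hp (b + b) (by linarith)
  have q1 := hq b hbβ
  have q2 := hq (b / 2) (by linarith)
  rw [sub_half] at c1
  rw [sub_neg_eq_add] at c2
  -- exponential moment of `m`
  have hM : logMgf (gibbs Q b v) m ≤ D + b / 2 * ∫ θ, u θ ∂(gibbs Q (b / 2) u)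
      + b * (∫ θ, v θ ∂(gibbs Q b u) - ∫ θ, u θ ∂(gibbs Q b u)) := by
    have hb1 : BddMeas (fun θ => -b * (v θ - u θ) + m θ - b / 2 * u θ) :=
      ((hw.const_mul _).add hm).sub (hu.const_mul _)
    -- As `β ≤ b/2`, the term `-βu` may be lowered to `-(b/2)u`; with the `-(b/2)u` of the reference
    -- measure, the total exponent becomes `-bv + m`.
    have e1 := (logMgf_mono (Q := gibbs Q (b / 2) u) hb1
      (((hw.const_mul (-b)).add hm).sub (hu.const_mul β)) (fun θ => by
        have := mul_le_mul_of_nonneg_right (show β ≤ b / 2 by linarith) (hu0 θ)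
        linarith)).trans E3
    rw [logMgf_gibbs hu hb1] at e1
    rw [logMgf_gibbs hv hm]
    rw [logMgf_gibbs hu (hu.const_mul _)] at c1
    have f1 : (fun θ => -(b / 2 * u θ) + (-b * (v θ - u θ) + m θ - b / 2 * u θ))
        = fun θ => -(b * v θ) + m θ := by funext θ; ring
    have f2 : (fun θ => -(b * u θ) + b / 2 * u θ) = fun θ => -(b / 2 * u θ) := by
      funext θ; ring
    rw [f1] at e1
    rw [f2] at c1
    linarith
  have hQ0 : 0 ≤ ∫ θ, u θ ∂(gibbs Q b u) := integral_nonneg hu0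
  have hmu0 : 0 ≤ ∫ θ, u θ ∂(gibbs Q b v) := integral_nonneg hu0
  have hq0 : 0 ≤ q := hp0.trans ((hp b hbβ).trans q1)
  generalize gibbsDiv Q b v u = K at *
  generalize (∫ θ, u θ ∂(gibbs Q b v)) = mu at *
  generalize (∫ θ, v θ ∂(gibbs Q b v)) = mv at *
  generalize (∫ θ, u θ ∂(gibbs Q b u)) = Qu at *
  generalize (∫ θ, v θ ∂(gibbs Q b u)) = Qv at *
  generalize (∫ θ, u θ ∂(gibbs Q (b / 2) u)) = Qu2 at *
  generalize (∫ θ, u θ ∂(gibbs Q (b + b) u)) = Qu3 at *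
  have hbmu : b * mu ≤ 2 * K + 2 * q := by linarith
  have hbQv : γ * (Qv - Qu) ≤ β * Qu + D := by linarith
  have hβmu : β * mu ≤ K / 2 + q / 2 := by
    have := mul_le_mul_of_nonneg_right hb hmu0
    linarith
  have hβQ : β * Qu ≤ q / 4 := by
    have := mul_le_mul_of_nonneg_right hb hQ0
    linarith
  -- Self-bounding: the right side of `h2` contains `3/2 K`, and `2b ≤ γ` makes its contribution at
  -- most three quarters of `γK`.
  have hgap : γ * K ≤ 4 * b * (q + 2 * D) := by
    have h1 : K ≤ b * (-(mv - mu) + (Qv - Qu)) := by linarith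
    have h2 : γ * (-(mv - mu) + (Qv - Qu)) ≤ 3 / 2 * K + 3 / 4 * q + 2 * D := by linarith
    have h3 := mul_le_mul_of_nonneg_left h1 hγ.le
    have h4 := mul_le_mul_of_nonneg_left h2 hb0.le
    have h5 := mul_le_mul_of_nonneg_right hbγ hK0
    have h6 := mul_nonneg hb0.le hq0
    linarith
  refine ⟨K, hK0, hgap, hbmu, ?_, ?_, ?_⟩
  · linarith
  · rw [abs_le]
    constructor <;> linarith
  · have h1 : b * (Qv - Qu) ≤ q + D := by
      by_cases h : 0 ≤ Qv - Qu
      · have := mul_le_mul_of_nonneg_right (show b ≤ γ by linarith) h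
        linarith
      · have := mul_nonneg hb0.le (neg_nonneg.2 (not_le.1 h).le)
        linarith
    linarith

end Tools

/-! ### Markov's inequality and elementary estimates. -/

/-- A uniform bound, by Markov's inequality, on finitely many averages of functions of expectation
at most `1`. -/
theorem exists_event_lintegral_le {Ω Θ ι : Type*} [MeasurableSpace Ω] [MeasurableSpace Θ]
    (μ : Measure Ω) [IsProbabilityMeasure μ] (J : Finset ι) (Q : ι → Measure Θ)
    (hQ : ∀ i ∈ J, IsProbabilityMeasure (Q i)) (F : ι → Θ × Ω → ENNReal)
    (hF : ∀ i ∈ J, Measurable (F i)) (hF1 : ∀ i ∈ J, ∀ θ, ∫⁻ ω, F i (θ, ω) ∂μ ≤ 1) {ε : ℝ}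
    (hε : 0 < ε) :
    ∃ E : Set Ω, MeasurableSet E ∧ ENNReal.ofReal (1 - ε) ≤ μ E ∧
      ∀ ω ∈ E, ∀ i ∈ J, ∫⁻ θ, F i (θ, ω) ∂(Q i) ≤ ENNReal.ofReal (J.card / ε) := by
  rcases J.eq_empty_or_nonempty with rfl | hJ
  · exact ⟨Set.univ, MeasurableSet.univ, by simp [hε.le], by simp⟩
  have hm : ∀ i ∈ J, Measurable (fun ω => ∫⁻ θ, F i (θ, ω) ∂(Q i)) := fun i hi => by
    have := hQ i hi
    exact (hF i hi).lintegral_prod_left'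
  have hW : Measurable (fun ω => ∑ i ∈ J, ∫⁻ θ, F i (θ, ω) ∂(Q i)) := Finset.measurable_fun_sum J hm
  have hint : ∫⁻ ω, ∑ i ∈ J, ∫⁻ θ, F i (θ, ω) ∂(Q i) ∂μ ≤ J.card := by
    rw [lintegral_finsetSum' J fun i hi => (hm i hi).aemeasurable]
    refine (Finset.sum_le_card_nsmul J _ 1 fun i hi => ?_).trans (by simp)
    have := hQ i hi
    -- Tonelli applies because `Q i` does not depend on the sample.
    rw [lintegral_lintegral_swap (f := fun ω θ => F i (θ, ω))
      ((hF i hi).comp measurable_swap).aemeasurable]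
    refine (lintegral_mono (hF1 i hi)).trans ?_
    simp
  set S : Set Ω :=
    {ω | ENNReal.ofReal (J.card / ε) ≤ ∑ i ∈ J, ∫⁻ θ, F i (θ, ω) ∂(Q i)} with hS
  have hSm : MeasurableSet S := measurableSet_le measurable_const hW
  have hc : (0 : ℝ) < J.card := by exact_mod_cast hJ.card_pos
  have hμS : μ S ≤ ENNReal.ofReal ε := by
    have h1 := (mul_meas_ge_le_lintegral (μ := μ) hW (ENNReal.ofReal (J.card / ε))).trans hint
    have h2 : (J.card : ENNReal) = ENNReal.ofReal (J.card / ε) * ENNReal.ofReal ε := by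
      rw [← ENNReal.ofReal_mul (by positivity), div_mul_cancel₀ _ hε.ne', ENNReal.ofReal_natCast]
    rw [h2] at h1
    exact (ENNReal.mul_le_mul_iff_right (by simpa using by positivity) ENNReal.ofReal_ne_top).1 h1
  refine ⟨Sᶜ, hSm.compl, ?_, fun ω hω i hi => ?_⟩
  · rw [prob_compl_eq_one_sub hSm, ENNReal.ofReal_sub _ hε.le, ENNReal.ofReal_one]
    exact tsub_le_tsub_left hμS 1
  · have h1 : ∑ i ∈ J, ∫⁻ θ, F i (θ, ω) ∂(Q i) < ENNReal.ofReal (J.card / ε) := by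
      simpa [hS] using hω
    exact (Finset.single_le_sum (f := fun i => ∫⁻ θ, F i (θ, ω) ∂(Q i))
      (fun _ _ => zero_le) hi).trans h1.le

theorem logMgf_le_of_lintegral_le {Θ : Type*} [MeasurableSpace Θ] {Q : Measure Θ}
    [IsProbabilityMeasure Q] {h : Θ → ℝ} (hh : BddMeas h) {c : ℝ} (hc : 0 ≤ c)
    (H : ∫⁻ θ, ENNReal.ofReal (Real.exp (h θ)) ∂Q ≤ ENNReal.ofReal c) :
    logMgf Q h ≤ Real.log c := by
  rw [← ofReal_integral_eq_lintegral_ofReal hh.exp.integrable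
    (Filter.Eventually.of_forall fun _ => (Real.exp_pos _).le), ENNReal.ofReal_le_ofReal_iff hc] at H
  exact Real.log_le_log hh.integral_exp_pos H

theorem exp_sign_le {ξ s k h : ℝ} (hξ : ξ = -1 ∨ ξ = 0 ∨ ξ = 1) (hs : |s| ≤ h) (hh : h ≤ 1 / 2)
    (hk0 : 0 ≤ k) (hk : k ≤ h ^ 2 / 2) :
    Real.exp (s * ξ + k * ξ ^ 2) ≤ 1 + s * ξ + 3 * h ^ 2 * ξ ^ 2 := by
  -- With y = s + k, exp y ≤ 1 + y + y² and |y| ≤ 5h/4; the second order terms total at most (1/2 +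
  -- 25/16)h².
  have key : ∀ s : ℝ, |s| ≤ h → Real.exp (s + k) ≤ 1 + s + 3 * h ^ 2 := by
    intro s hs
    obtain ⟨h1, h2⟩ := abs_le.1 hs
    have h0 : 0 ≤ h := (abs_nonneg _).trans hs
    have hy : |s + k| ≤ 5 / 4 * h := by
      rw [abs_le]
      constructor <;> nlinarith
    have e1 := (abs_le.1 (Real.abs_exp_sub_one_sub_id_le (hy.trans (by linarith)))).2
    have e2 : (s + k) ^ 2 ≤ (5 / 4 * h) ^ 2 := sq_le_sq' (abs_le.1 hy).1 (abs_le.1 hy).2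
    nlinarith [sq_nonneg h]
  rcases hξ with rfl | rfl | rfl
  · have := key (-s) (by rwa [abs_neg])
    ring_nf at this ⊢
    linarith
  · simp
  · have := key s hs
    ring_nf at this ⊢
    linarith

/-! ### Error indicators and the empirical pseudo-distance. -/

section Basic

variable {X Y Θ : Type*} {N : ℕ} {f : Θ → X → Y}

theorem err_eq_zero_or_one (f : Θ → X → Y) (θ : Θ) (z : X × Y) : err f θ z = 0 ∨ err f θ z = 1 := by
  unfold err
  by_cases h : z ∈ {z : X × Y | f θ z.1 ≠ z.2}
  · right; rw [Set.indicator_of_mem h]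
  · left; rw [Set.indicator_of_notMem h]

theorem empDist_nonneg (ω : Fin N → X × Y) (θ θ' : Θ) : 0 ≤ empDist f ω θ θ' :=
  mul_nonneg (by positivity) (Finset.sum_nonneg fun _ _ => sq_nonneg _)

theorem empDist_triangle (ω : Fin N → X × Y) (θ θ' θt : Θ) :
    empDist f ω θ θ' ≤ empDist f ω θ θt + empDist f ω θ' θt := by
  unfold empDist
  rw [← mul_add, ← Finset.sum_add_distrib]
  refine mul_le_mul_of_nonneg_left (Finset.sum_le_sum fun i _ => ?_) (by positivity)
  rcases err_eq_zero_or_one f θ (ω i) with h | h <;>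
    rcases err_eq_zero_or_one f θ' (ω i) with h' | h' <;>
    rcases err_eq_zero_or_one f θt (ω i) with h'' | h'' <;> norm_num [h, h', h'']

theorem abs_average_le {N : ℕ} (a : Fin N → ℝ) (ha : ∀ i, |a i| ≤ 1) : |1 / (N : ℝ) * ∑ i, a i| ≤ 1 := by
  rw [abs_mul, abs_of_nonneg (by positivity)]
  have h1 : |∑ i, a i| ≤ N := by
    refine (Finset.abs_sum_le_sum_abs _ _).trans ?_
    refine (Finset.sum_le_sum fun i _ => ha i).trans ?_
    simp
  refine (mul_le_mul_of_nonneg_left h1 (by positivity)).trans ?_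
  rw [one_div]
  exact inv_mul_le_one

theorem abs_err_sub_sq_le (θ θ' : Θ) (z : X × Y) : |(err f θ z - err f θ' z) ^ 2| ≤ 1 := by
  rcases err_eq_zero_or_one f θ z with h | h <;>
    rcases err_eq_zero_or_one f θ' z with h' | h' <;> simp [h, h']

theorem abs_empDist_le (ω : Fin N → X × Y) (θ θ' : Θ) : |empDist f ω θ θ'| ≤ 1 :=
  abs_average_le _ fun _ => abs_err_sub_sq_le _ _ _

end Basic

/-! ### Measurability and exponential inequalities for the sample. -/

section Sample

variable {X Y Θ : Type*} [MeasurableSpace X] [Finite Y] [MeasurableSpace Y]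
  [DiscreteMeasurableSpace Y] [MeasurableSpace Θ] {N : ℕ} {P : Fin N → Measure (X × Y)}
  {f : Θ → X → Y}

theorem measurable_err (hf : Measurable (fun p : Θ × X => f p.1 p.2)) :
    Measurable (fun p : Θ × (X × Y) => err f p.1 p.2) := by
  have h1 : Measurable (fun p : Θ × (X × Y) => (f p.1 p.2.1, p.2.2)) := by
    refine Measurable.prodMk ?_ (by fun_prop)
    exact hf.comp (measurable_fst.prodMk (measurable_fst.comp measurable_snd))
  have h2 : MeasurableSet {q : Y × Y | q.1 ≠ q.2} := MeasurableSet.of_discrete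
  exact measurable_const.indicator (h1 h2)

theorem measurable_err_left (hf : Measurable (fun p : Θ × X => f p.1 p.2)) (θ : Θ) :
    Measurable (err f θ) :=
  (measurable_err hf).comp measurable_prodMk_left

theorem measureReal_ne_eq (hf : Measurable (fun p : Θ × X => f p.1 p.2)) (θ : Θ)
    (p : Measure (X × Y)) : p.real {z : X × Y | f θ z.1 ≠ z.2} = ∫ z, err f θ z ∂p := by
  have hs : MeasurableSet {z : X × Y | f θ z.1 ≠ z.2} := by
    have : {z : X × Y | f θ z.1 ≠ z.2} = err f θ ⁻¹' {1} := by
      ext z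
      simp [err]
    rw [this]
    exact measurable_err_left hf θ (measurableSet_singleton 1)
  exact (integral_indicator_one hs).symm

/-- The exponential moment of one term of the deviations. -/
theorem integral_exp_single_le (hf : Measurable (fun p : Θ × X => f p.1 p.2)) (p : Measure (X × Y))
    [IsProbabilityMeasure p] (θ θ' : Θ) {s k h : ℝ} (hs : |s| ≤ h) (hh : h ≤ 1 / 2)
    (hk0 : 0 ≤ k) (hk : k ≤ h ^ 2 / 2) :
    ∫ z, Real.exp (s * ((err f θ z - err f θ' z)
        - (p.real {z : X × Y | f θ z.1 ≠ z.2} - p.real {z : X × Y | f θ' z.1 ≠ z.2}))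
      + k * (err f θ z - err f θ' z) ^ 2
      - 3 * h ^ 2 * ∫ z, (err f θ z - err f θ' z) ^ 2 ∂p) ∂p ≤ 1 := by
  have hb : ∀ θ, BddMeas (err f θ) := fun θ => ⟨measurable_err_left hf θ, 1, fun z => by
    rcases err_eq_zero_or_one f θ z with h | h <;> simp [h]⟩
  have hξ : ∀ z, err f θ z - err f θ' z = -1 ∨ err f θ z - err f θ' z = 0 ∨
      err f θ z - err f θ' z = 1 := fun z => by
    rcases err_eq_zero_or_one f θ z with h | h <;> rcases err_eq_zero_or_one f θ' z with h' | h' <;>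
      simp [h, h']
  have hb1 := (hb θ).sub (hb θ')
  have hb2 : BddMeas (fun z => (err f θ z - err f θ' z) ^ 2) := ⟨hb1.1.pow_const 2, 1, fun z => by
    rcases hξ z with h | h | h <;> simp [h]⟩
  rw [measureReal_ne_eq hf, measureReal_ne_eq hf, ← integral_sub (hb θ).integrable (hb θ').integrable]
  set a := ∫ z, (err f θ z - err f θ' z) ∂p
  set v := ∫ z, (err f θ z - err f θ' z) ^ 2 ∂p
  have e1 : ∀ z, Real.exp (s * ((err f θ z - err f θ' z) - a) + k * (err f θ z - err f θ' z) ^ 2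
      - 3 * h ^ 2 * v) = Real.exp (-(s * a + 3 * h ^ 2 * v)) *
        Real.exp (s * (err f θ z - err f θ' z) + k * (err f θ z - err f θ' z) ^ 2) := by
    intro z
    rw [← Real.exp_add]
    ring_nf
  simp_rw [e1]
  rw [integral_const_mul]
  have e2 : ∫ z, Real.exp (s * (err f θ z - err f θ' z) + k * (err f θ z - err f θ' z) ^ 2) ∂p
      ≤ 1 + s * a + 3 * h ^ 2 * v := by
    calc _ ≤ ∫ z, (1 + s * (err f θ z - err f θ' z) + 3 * h ^ 2 * (err f θ z - err f θ' z) ^ 2) ∂p :=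
          integral_mono ((hb1.const_mul s).add (hb2.const_mul k)).exp.integrable
            (((BddMeas.const 1).add (hb1.const_mul s)).add (hb2.const_mul _)).integrable
            fun z => exp_sign_le (hξ z) hs hh hk0 hk
      _ = _ := by
          rw [integral_add ((BddMeas.const 1).add (hb1.const_mul s)).integrable
            (hb2.const_mul _).integrable, integral_add (BddMeas.const 1).integrable
            (hb1.const_mul s).integrable, integral_const_mul, integral_const_mul]
          simp [a, v]
  have e3 := Real.add_one_le_exp (s * a + 3 * h ^ 2 * v)
  calc _ ≤ Real.exp (-(s * a + 3 * h ^ 2 * v)) * Real.exp (s * a + 3 * h ^ 2 * v) :=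
        mul_le_mul_of_nonneg_left (by linarith) (Real.exp_pos _).le
    _ = 1 := by rw [← Real.exp_add]; simp

/-- The deviation functional of the exponential inequalities. -/
noncomputable def deviation (P : Fin N → Measure (X × Y)) (f : Θ → X → Y) (θt : Θ) (t c g : ℝ)
    (ω : Fin N → X × Y) (θ : Θ) : ℝ :=
  t * ((empRisk f ω θ - empRisk f ω θt) - (risk P f θ - risk P f θt)) + c * empDist f ω θ θt
    - 3 * (g ^ 2 / N) * expDist P f θ θt

/-- Independence factors the exponential over the coordinates, and each factor has mean at most 1 by
`integral_exp_single_le` with `h = g/N`. -/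
theorem integral_exp_deviation_le [∀ i, IsProbabilityMeasure (P i)]
    (hf : Measurable (fun p : Θ × X => f p.1 p.2)) (θ θt : Θ) (hN : 0 < N) {t c g : ℝ}
    (ht : |t| ≤ g) (hg : g ≤ N / 2) (hc0 : 0 ≤ c) (hc : c ≤ g ^ 2 / (2 * N)) :
    ∫ ω, Real.exp (deviation P f θt t c g ω θ) ∂(Measure.pi P) ≤ 1 := by
  have hN' : (0 : ℝ) < N := by exact_mod_cast hN
  have e : ∀ ω : Fin N → X × Y, Real.exp (deviation P f θt t c g ω θ) =
      ∏ i, Real.exp (t / N * ((err f θ (ω i) - err f θt (ω i))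
        - ((P i).real {z : X × Y | f θ z.1 ≠ z.2} - (P i).real {z : X × Y | f θt z.1 ≠ z.2}))
      + c / N * (err f θ (ω i) - err f θt (ω i)) ^ 2
      - 3 * (g / N) ^ 2 * ∫ z, (err f θ z - err f θt z) ^ 2 ∂(P i)) := by
    intro ω
    rw [← Real.exp_sum]
    congr 1
    unfold deviation empRisk risk empDist expDist
    simp only [Finset.sum_sub_distrib, Finset.sum_add_distrib, ← Finset.mul_sum]
    field_simp
  simp_rw [e]
  rw [integral_fintype_prod_eq_prod (μ := P) (f := fun i z => Real.exp (t / N * ((err f θ z - err f θt z)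
        - ((P i).real {z : X × Y | f θ z.1 ≠ z.2} - (P i).real {z : X × Y | f θt z.1 ≠ z.2}))
      + c / N * (err f θ z - err f θt z) ^ 2
      - 3 * (g / N) ^ 2 * ∫ z, (err f θ z - err f θt z) ^ 2 ∂(P i)))]
  refine Finset.prod_le_one (fun i _ => integral_nonneg fun _ => (Real.exp_pos _).le) fun i _ => ?_
  refine integral_exp_single_le hf (P i) θ θt ?_ ?_ (by positivity) ?_
  · rw [abs_div, abs_of_pos hN']
    gcongr
  · rw [div_le_iff₀ hN']
    linarith
  · rw [div_le_iff₀ hN']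
    refine hc.trans (le_of_eq ?_)
    field_simp

theorem bddMeas_empRisk (hf : Measurable (fun p : Θ × X => f p.1 p.2)) (ω : Fin N → X × Y) :
    BddMeas (empRisk f ω) := by
  refine ⟨?_, 1, fun θ => abs_average_le _ fun i => ?_⟩
  · unfold empRisk
    refine (Finset.measurable_fun_sum _ fun i _ => ?_).const_mul _
    exact (measurable_err hf).comp measurable_prodMk_right
  · rcases err_eq_zero_or_one f θ (ω i) with h | h <;> simp [h]

theorem bddMeas_empDist (hf : Measurable (fun p : Θ × X => f p.1 p.2)) (ω : Fin N → X × Y)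
    (θt : Θ) : BddMeas (fun θ => empDist f ω θ θt) := by
  refine ⟨?_, 1, fun θ => abs_empDist_le ω θ θt⟩
  unfold empDist
  refine (Finset.measurable_fun_sum _ fun i _ => ?_).const_mul _
  exact (((measurable_err hf).comp measurable_prodMk_right).sub_const _).pow_const 2

theorem bddMeas_risk [∀ i, IsProbabilityMeasure (P i)]
    (hf : Measurable (fun p : Θ × X => f p.1 p.2)) : BddMeas (risk P f) := by
  refine ⟨?_, 1, fun θ => abs_average_le _ fun i => ?_⟩
  · unfold risk
    refine (Finset.measurable_fun_sum _ fun i _ => ?_).const_mul _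
    simp_rw [measureReal_ne_eq hf]
    exact ((measurable_err hf).stronglyMeasurable.integral_prod_right' (ν := P i)).measurable
  · rw [abs_of_nonneg measureReal_nonneg]
    exact measureReal_le_one

theorem bddMeas_expDist [∀ i, IsProbabilityMeasure (P i)]
    (hf : Measurable (fun p : Θ × X => f p.1 p.2)) (θt : Θ) :
    BddMeas (fun θ => expDist P f θ θt) := by
  refine ⟨?_, 1, fun θ => abs_average_le _ fun i => ?_⟩
  · unfold expDist
    refine (Finset.measurable_fun_sum _ fun i _ => ?_).const_mul _
    have h : Measurable (fun p : Θ × (X × Y) => (err f p.1 p.2 - err f θt p.2) ^ 2) :=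
      ((measurable_err hf).sub ((measurable_err_left hf θt).comp measurable_snd)).pow_const 2
    exact (h.stronglyMeasurable.integral_prod_right' (ν := P i)).measurable
  · refine (norm_integral_le_of_norm_le_const (C := 1)
      (Filter.Eventually.of_forall fun z => (Real.norm_eq_abs _).trans_le (abs_err_sub_sq_le θ θt z))).trans ?_
    simp

theorem measurable_deviation [∀ i, IsProbabilityMeasure (P i)]
    (hf : Measurable (fun p : Θ × X => f p.1 p.2)) (θt : Θ) (t c g : ℝ) :
    Measurable (fun p : Θ × (Fin N → X × Y) => deviation P f θt t c g p.2 p.1) := by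
  have h1 : ∀ i, Measurable (fun p : Θ × (Fin N → X × Y) => err f p.1 (p.2 i)) := fun i =>
    (measurable_err hf).comp (measurable_fst.prodMk ((measurable_pi_apply i).comp measurable_snd))
  have h2 : ∀ i, Measurable (fun p : Θ × (Fin N → X × Y) => err f θt (p.2 i)) := fun i =>
    (measurable_err_left hf θt).comp ((measurable_pi_apply i).comp measurable_snd)
  have h3 := (bddMeas_risk (P := P) hf).1.comp
    (measurable_fst : Measurable (Prod.fst : Θ × (Fin N → X × Y) → Θ))
  have h4 := (bddMeas_expDist (P := P) hf θt).1.comp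
    (measurable_fst : Measurable (Prod.fst : Θ × (Fin N → X × Y) → Θ))
  unfold deviation empRisk empDist
  refine (((((Finset.measurable_fun_sum _ fun i _ => h1 i).const_mul _).sub
    ((Finset.measurable_fun_sum _ fun i _ => h2 i).const_mul _)).sub (h3.sub_const _)).const_mul
    _).add (((Finset.measurable_fun_sum _ fun i _ => ((h1 i).sub (h2 i)).pow_const 2).const_mul
    _).const_mul _) |>.sub (h4.const_mul _)

theorem bddMeas_deviation [∀ i, IsProbabilityMeasure (P i)]
    (hf : Measurable (fun p : Θ × X => f p.1 p.2)) (θt : Θ) (t c g : ℝ) (ω : Fin N → X × Y) :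
    BddMeas (deviation P f θt t c g ω) :=
  (((((bddMeas_empRisk hf ω).sub (BddMeas.const _)).sub ((bddMeas_risk hf).sub
    (BddMeas.const _))).const_mul t).add ((bddMeas_empDist hf ω θt).const_mul c)).sub
    ((bddMeas_expDist hf θt).const_mul _)

theorem bddMeas_empRisk_sample (hf : Measurable (fun p : Θ × X => f p.1 p.2)) (θ : Θ) :
    BddMeas (fun ω : Fin N → X × Y => empRisk f ω θ) := by
  refine ⟨?_, 1, fun ω => abs_average_le _ fun i => ?_⟩
  · unfold empRisk
    exact (Finset.measurable_fun_sum _ fun i _ =>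
      (measurable_err_left hf θ).comp (measurable_pi_apply i)).const_mul _
  · rcases err_eq_zero_or_one f θ (ω i) with h | h <;> simp [h]

theorem bddMeas_empDist_sample (hf : Measurable (fun p : Θ × X => f p.1 p.2)) (θ θt : Θ) :
    BddMeas (fun ω : Fin N → X × Y => empDist f ω θ θt) := by
  refine ⟨?_, 1, fun ω => abs_empDist_le ω θ θt⟩
  unfold empDist
  exact (Finset.measurable_fun_sum _ fun i _ =>
    (((measurable_err_left hf θ).comp (measurable_pi_apply i)).sub
      ((measurable_err_left hf θt).comp (measurable_pi_apply i))).pow_const 2).const_mul _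

theorem bddMeas_deviation_sample (hf : Measurable (fun p : Θ × X => f p.1 p.2)) (θ θt : Θ)
    (t c g : ℝ) : BddMeas (fun ω => deviation P f θt t c g ω θ) :=
  (((((bddMeas_empRisk_sample hf θ).sub (bddMeas_empRisk_sample hf θt)).sub
    (BddMeas.const _)).const_mul t).add ((bddMeas_empDist_sample hf θ θt).const_mul c)).sub
    (BddMeas.const _)

/-- Finitely many exponential inequalities holding simultaneously. -/
theorem exists_event_deviation [∀ i, IsProbabilityMeasure (P i)]
    (hf : Measurable (fun p : Θ × X => f p.1 p.2)) (θt : Θ) (hN : 0 < N) (π : Measure Θ)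
    [IsProbabilityMeasure π] {ι : Type*} (J : Finset ι) (b t c g : ι → ℝ)
    (h : ∀ i ∈ J, |t i| ≤ g i ∧ g i ≤ N / 2 ∧ 0 ≤ c i ∧ c i ≤ g i ^ 2 / (2 * N)) {ε : ℝ}
    (hε : 0 < ε) :
    ∃ E : Set (Fin N → X × Y), MeasurableSet E ∧ ENNReal.ofReal (1 - ε) ≤ Measure.pi P E ∧
      ∀ ω ∈ E, ∀ i ∈ J,
        logMgf (gibbs π (b i) (risk P f)) (deviation P f θt (t i) (c i) (g i) ω)
          ≤ Real.log (J.card / ε) := by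
  obtain ⟨E, hE, hPE, H⟩ := exists_event_lintegral_le (Measure.pi P) J
    (fun i => gibbs π (b i) (risk P f))
    (fun i _ => isProbabilityMeasure_gibbs (bddMeas_risk hf) _)
    (fun i p => ENNReal.ofReal (Real.exp (deviation P f θt (t i) (c i) (g i) p.2 p.1)))
    (fun i _ => (measurable_deviation hf θt _ _ _).exp.ennreal_ofReal)
    (fun i hi θ => by
      obtain ⟨h1, h2, h3, h4⟩ := h i hi
      have hb : BddMeas (fun ω => deviation P f θt (t i) (c i) (g i) ω θ) :=
        bddMeas_deviation_sample hf θ θt _ _ _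
      rw [← ofReal_integral_eq_lintegral_ofReal hb.exp.integrable
        (Filter.Eventually.of_forall fun _ => (Real.exp_pos _).le), ENNReal.ofReal_le_one]
      exact integral_exp_deviation_le hf θ θt hN h1 h2 h3 h4)
    hε
  refine ⟨E, hE, hPE, fun ω hω i hi => ?_⟩
  have := isProbabilityMeasure_gibbs (Q := π) (bddMeas_risk (P := P) hf) (b i)
  exact logMgf_le_of_lintegral_le (bddMeas_deviation hf θt _ _ _ ω) (by positivity) (H ω hω i hi)

end Sample

/-! ### Hyperbolic functions and the inverse of F. -/

section Functions

theorem half_le_tanh {s : ℝ} (h0 : 0 ≤ s) (h1 : s ≤ 1 / 2) : s / 2 ≤ Real.tanh s := by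
  have hc : Real.cosh s ≤ 2 := by
    have h2 := Real.exp_bound_div_one_sub_of_interval (x := s ^ 2 / 2) (by positivity) (by nlinarith)
    refine (Real.cosh_le_exp_half_sq s).trans (h2.trans ?_)
    rw [div_le_iff₀ (by nlinarith)]
    nlinarith
  rw [Real.tanh_eq_sinh_div_cosh, le_div_iff₀ (Real.cosh_pos s)]
  have := Real.self_le_sinh_iff.2 h0
  nlinarith

theorem mul_log_cosh_le {N : ℕ} (hN : 0 < N) (γ : ℝ) :
    (N : ℝ) * Real.log (Real.cosh (γ / N)) ≤ γ ^ 2 / (2 * N) := by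
  have hN' : (0 : ℝ) < N := by exact_mod_cast hN
  have h := Real.log_le_log (Real.cosh_pos (γ / N)) (Real.cosh_le_exp_half_sq (γ / N))
  rw [Real.log_exp] at h
  refine (mul_le_mul_of_nonneg_left h hN'.le).trans (le_of_eq ?_)
  field_simp

theorem mul_log_cosh_nonneg (N : ℕ) (γ : ℝ) : 0 ≤ (N : ℝ) * Real.log (Real.cosh (γ / N)) :=
  mul_nonneg (Nat.cast_nonneg N) (Real.log_nonneg (Real.one_le_cosh _))

/-- Since −log(1 − s) ≥ s, the function F lies above the line of slope `N tanh(γ/N) - a`. That 0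
belongs to the set makes it nonempty, as the supremum bound requires. -/
theorem FFinv_le {N : ℕ} {γ a y : ℝ} (ha : a < N * Real.tanh (γ / N)) (hy : 0 ≤ y) :
    FFinv N γ a y ≤ y / (N * Real.tanh (γ / N) - a) := by
  refine csSup_le ⟨0, by simp, by simpa [FF] using hy⟩ ?_
  rintro x ⟨hx1, hx2⟩
  rw [le_div_iff₀ (by linarith)]
  have h := Real.log_le_sub_one_of_pos (show 0 < 1 - Real.tanh (γ / N) * x by linarith)
  have h' := mul_le_mul_of_nonneg_left h (Nat.cast_nonneg (α := ℝ) N)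
  unfold FF at hx2
  linarith

end Functions

/-! ### The geometric grid and its uniform measure. -/

section Grid

variable {N : ℕ} {α : ℝ}

theorem grid_subset_image (N : ℕ) (α : ℝ) :
    grid N α ⊆ ((Finset.range ⌈Real.log N / Real.log α⌉₊).image (fun k => α ^ k) : Finset ℝ) := by
  rintro b ⟨k, hk, rfl⟩
  simp only [Finset.coe_image, Set.mem_image, Finset.coe_range, Set.mem_Iio]
  exact ⟨k, Nat.lt_ceil.2 hk, rfl⟩

theorem grid_finite (N : ℕ) (α : ℝ) : (grid N α).Finite :=
  (Finset.finite_toSet _).subset (grid_subset_image N α)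

theorem ncard_grid_le (h : 0 ≤ Real.log N / Real.log α) :
    ((grid N α).ncard : ℝ) ≤ Real.log N / Real.log α + 1 := by
  refine le_trans ?_ (Nat.ceil_lt_add_one h).le
  have h1 := Set.ncard_le_ncard (grid_subset_image N α) (Finset.finite_toSet _)
  rw [Set.ncard_coe_finset] at h1
  have h2 := h1.trans Finset.card_image_le
  rw [Finset.card_range] at h2
  exact_mod_cast h2

theorem one_le_of_mem_grid (hα : 1 < α) {b : ℝ} (hb : b ∈ grid N α) : 1 ≤ b := by
  obtain ⟨k, -, rfl⟩ := hb
  exact one_le_pow₀ hα.le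

theorem mul_le_of_mem_grid (hα : 1 < α) {b g : ℝ} (hb : b ∈ grid N α) (hg : g ∈ grid N α)
    (h : b < g) : α * b ≤ g := by
  obtain ⟨k, -, rfl⟩ := hb
  obtain ⟨l, -, rfl⟩ := hg
  rw [← pow_succ']
  exact pow_le_pow_right₀ hα.le ((pow_lt_pow_iff_right₀ hα).1 h)

theorem uniformOn_grid_singleton {b : ℝ} (hb : b ∈ grid N α) :
    ProbabilityTheory.uniformOn (grid N α) {b} = ((grid N α).ncard : ENNReal)⁻¹ := by
  have hfin := grid_finite N α
  rw [ProbabilityTheory.uniformOn, ProbabilityTheory.cond_apply hfin.measurableSet,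
    Set.inter_eq_right.2 (Set.singleton_subset_iff.2 hb), Measure.count_singleton, mul_one,
    Measure.count_apply_finite _ hfin, Set.ncard_eq_toFinset_card _ hfin]

end Grid

/-! ### Accounting on a fixed sample. -/

section Deterministic

variable {X Y Θ : Type*} [MeasurableSpace X] [Finite Y] [MeasurableSpace Y]
  [DiscreteMeasurableSpace Y] [MeasurableSpace Θ] {N : ℕ} {f : Θ → X → Y}

/-- The triangle inequality through `θt` splits ρ(m') into m'(θ, θ̃) and a constant, its ρ-mean.
Jensen bounds the constant's contribution by the same log-Laplace transform, whence the factor 2. -/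
theorem logLaplace_mem (hf : Measurable (fun p : Θ × X => f p.1 p.2)) (θt : Θ) (hN : 0 < N)
    (π : Measure Θ) [IsProbabilityMeasure π] (ω : Fin N → X × Y) (γ b : ℝ) :
    0 ≤ logLaplace f π ω γ b (gibbs π b (empRisk f ω)) ∧
    logLaplace f π ω γ b (gibbs π b (empRisk f ω)) ≤
      2 * logMgf (gibbs π b (empRisk f ω)) (fun θ => γ ^ 2 / (2 * N) * empDist f ω θ θt) := by
  have := isProbabilityMeasure_gibbs (Q := π) (bddMeas_empRisk hf ω) b
  set ρ := gibbs π b (empRisk f ω) with hρ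
  set k := (N : ℝ) * Real.log (Real.cosh (γ / N))
  set c := γ ^ 2 / (2 * (N : ℝ))
  have hk0 : 0 ≤ k := mul_log_cosh_nonneg N γ
  have hkc : k ≤ c := mul_log_cosh_le hN γ
  have hm := bddMeas_empDist hf ω θt
  have hint0 : ∀ θ, 0 ≤ ∫ θ', empDist f ω θ θ' ∂ρ := fun θ =>
    integral_nonneg fun θ' => empDist_nonneg ω θ θ'
  have hJm : Measurable (fun p : Θ × Θ => empDist f ω p.1 p.2) := by
    unfold empDist
    exact (Finset.measurable_fun_sum _ fun i _ =>
      ((((measurable_err hf).comp measurable_prodMk_right).comp measurable_fst).sub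
        (((measurable_err hf).comp measurable_prodMk_right).comp measurable_snd)).pow_const
          2).const_mul _
  have hle : ∀ θ, ∫ θ', empDist f ω θ θ' ∂ρ ≤ empDist f ω θ θt + ∫ θ', empDist f ω θ' θt ∂ρ := by
    intro θ
    have hb : BddMeas (fun θ' => empDist f ω θ θ') :=
      ⟨Measurable.of_uncurry_left (f := empDist f ω) hJm, 1, fun θ' => abs_empDist_le ω θ θ'⟩
    have h : ∫ θ', empDist f ω θ θ' ∂ρ ≤ ∫ θ', (empDist f ω θ θt + empDist f ω θ' θt) ∂ρ :=
      integral_mono hb.integrable ((BddMeas.const _).add hm).integrable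
        (fun θ' => empDist_triangle ω θ θ' θt)
    rw [integral_add (BddMeas.const _).integrable hm.integrable] at h
    simpa using h
  have hb : BddMeas (fun θ => ∫ θ', empDist f ω θ θ' ∂ρ) := by
    refine ⟨(hJm.stronglyMeasurable.integral_prod_right' (ν := ρ)).measurable, 1, fun θ => ?_⟩
    refine (norm_integral_le_of_norm_le_const (C := 1)
      (Filter.Eventually.of_forall fun z => (Real.norm_eq_abs _).trans_le
        (abs_empDist_le ω θ z))).trans ?_
    simp
  have hL : logLaplace f π ω γ b ρ = logMgf ρ (fun θ => k * ∫ θ', empDist f ω θ θ' ∂ρ) := rfl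
  rw [hL]
  constructor
  · rw [← logMgf_zero (Q := ρ)]
    exact logMgf_mono (BddMeas.const 0) (hb.const_mul k) fun θ => mul_nonneg hk0 (hint0 θ)
  · have h1 := logMgf_mono (Q := ρ) (hb.const_mul k)
      ((hm.const_mul c).add (BddMeas.const (c * ∫ θ', empDist f ω θ' θt ∂ρ))) (fun θ => by
        rw [← mul_add]
        exact (mul_le_mul_of_nonneg_right hkc (hint0 θ)).trans
          (mul_le_mul_of_nonneg_left (hle θ) (hk0.trans hkc)))
    rw [logMgf_add_const (hm.const_mul c)] at h1
    have h2 := integral_le_logMgf (Q := ρ) (hm.const_mul c)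
    rw [integral_const_mul] at h2
    linarith

/-- `gibbs_comparison` is used at `4β` for a lower bound on the empirical excess risk and at `γ/2`
for an upper bound. Everything is then measured in units of `q' = q + 2D`. -/
theorem bound_expression_nonpos (hf : Measurable (fun p : Θ × X => f p.1 p.2)) (θt : Θ)
    (hN : 0 < N) (π : Measure Θ) [IsProbabilityMeasure π] (ω : Fin N → X × Y) {u : Θ → ℝ}
    (hu : BddMeas u) (hu0 : ∀ θ, 0 ≤ u θ) {β γ p q D l : ℝ} (hβ : 0 < β) (hβγ : 8 * β ≤ γ)
    (hγN : γ / N ≤ 1 / 2) (hl0 : l ≤ 0) (hlD : -l ≤ D) (hp0 : 0 < p)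
    (hp : ∀ b', β ≤ b' → p ≤ b' * ∫ θ, u θ ∂(gibbs π b' u))
    (hq : ∀ b', β ≤ b' → b' * ∫ θ, u θ ∂(gibbs π b' u) ≤ q)
    (hsmall : 1000 * β * (q + 2 * D) ≤ p * γ)
    (H : ∀ b, b = 4 * β ∨ b = γ / 2 →
      logMgf (gibbs π b u)
        (fun θ => -γ * (empRisk f ω θ - empRisk f ω θt - u θ) - β * u θ) ≤ D ∧
      logMgf (gibbs π b u)
        (fun θ => γ * (empRisk f ω θ - empRisk f ω θt - u θ) - β * u θ) ≤ D ∧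
      logMgf (gibbs π (b / 2) u)
        (fun θ => -b * (empRisk f ω θ - empRisk f ω θt - u θ)
          + γ ^ 2 / (2 * N) * empDist f ω θ θt - β * u θ) ≤ D) :
    (γ - γ / 2) * (∫ θ, empRisk f ω θ ∂(gibbs π (γ / 2) (empRisk f ω))
            - ∫ θ, empRisk f ω θ ∂(gibbs π (4 * β) (empRisk f ω)))
        + logLaplace f π ω γ (γ / 2) (gibbs π (γ / 2) (empRisk f ω)) - l
        + (γ - γ / 2) * (β / (4 * β)) * FFinv N γ (β * γ / (4 * β))
            (logLaplace f π ω γ (4 * β) (gibbs π (4 * β) (empRisk f ω)) - l) ≤ 0 ∧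
    β * ∫ θ, u θ ∂(gibbs π (γ / 2) (empRisk f ω)) ≤ p := by
  have hN' : (0 : ℝ) < N := by exact_mod_cast hN
  have hγ : 0 < γ := by linarith
  have hr := bddMeas_empRisk hf ω
  have hv : BddMeas (fun θ => empRisk f ω θ - empRisk f ω θt) := hr.sub (BddMeas.const _)
  have hm := (bddMeas_empDist hf ω θt).const_mul (γ ^ 2 / (2 * N))
  have hD : 0 ≤ D := by linarith
  obtain ⟨E1, E2, E3⟩ := H (4 * β) (Or.inl rfl)
  obtain ⟨F1, F2, F3⟩ := H (γ / 2) (Or.inr rfl)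
  obtain ⟨K, hK0, hK, hKu, hKl, hKv, hKm⟩ := gibbs_comparison hu hv hm hu0 hβ le_rfl
    (by linarith) hD hp0.le hp hq E1 E2 E3
  obtain ⟨K', hK0', hK', hKu', -, hKv', hKm'⟩ := gibbs_comparison hu hv hm hu0 hβ
    (show 4 * β ≤ γ / 2 by linarith) (by linarith) hD hp0.le hp hq F1 F2 F3
  simp only [gibbs_sub_const] at hKu hKl hKv hKm hKu' hKv' hKm'
  obtain ⟨a0, a1⟩ := logLaplace_mem hf θt hN π ω γ (4 * β)
  obtain ⟨a0', a1'⟩ := logLaplace_mem hf θt hN π ω γ (γ / 2)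
  have i1 := isProbabilityMeasure_gibbs (Q := π) hr (4 * β)
  have i2 := isProbabilityMeasure_gibbs (Q := π) hr (γ / 2)
  rw [integral_sub hr.integrable (BddMeas.const _).integrable] at hKv hKv'
  simp only [integral_const, measureReal_def, measure_univ, ENNReal.toReal_one, one_smul]
    at hKv hKv'
  have hpq : p ≤ q := (hp β le_rfl).trans (hq β le_rfl)
  have hU0 : 0 ≤ ∫ θ, u θ ∂(gibbs π (4 * β) (empRisk f ω)) := integral_nonneg hu0
  have hU0' : 0 ≤ ∫ θ, u θ ∂(gibbs π (γ / 2) (empRisk f ω)) := integral_nonneg hu0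
  have hFF : FFinv N γ (β * γ / (4 * β))
      (logLaplace f π ω γ (4 * β) (gibbs π (4 * β) (empRisk f ω)) - l)
      ≤ 4 / γ * (logLaplace f π ω γ (4 * β) (gibbs π (4 * β) (empRisk f ω)) - l) := by
    have e : β * γ / (4 * β) = γ / 4 := by field_simp
    have ht := half_le_tanh (s := γ / N) (by positivity) hγN
    have ht' : γ / 2 ≤ N * Real.tanh (γ / N) := by
      have := mul_le_mul_of_nonneg_left ht hN'.le
      have e2 : (N : ℝ) * (γ / N / 2) = γ / 2 := by field_simp
      linarith
    rw [e]
    refine (FFinv_le (by linarith) (by linarith)).trans ?_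
    rw [div_eq_inv_mul]
    refine mul_le_mul_of_nonneg_right ?_ (by linarith)
    rw [inv_le_comm₀ (by linarith) (by positivity), inv_div]
    linarith
  have e3 : (γ - γ / 2) * (β / (4 * β)) = γ / 8 := by field_simp; ring
  rw [e3]
  have hFF' := mul_le_mul_of_nonneg_left hFF (show 0 ≤ γ / 8 by positivity)
  have e4 : ∀ y, γ / 8 * (4 / γ * y) = y / 2 := fun y => by field_simp; ring
  rw [e4] at hFF'
  generalize logLaplace f π ω γ (4 * β) (gibbs π (4 * β) (empRisk f ω)) = L1 at *
  generalize logLaplace f π ω γ (γ / 2) (gibbs π (γ / 2) (empRisk f ω)) = L2 at *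
  generalize (∫ θ, u θ ∂(gibbs π (4 * β) (empRisk f ω))) = U1 at *
  generalize (∫ θ, u θ ∂(gibbs π (γ / 2) (empRisk f ω))) = U2 at *
  generalize (∫ θ, empRisk f ω θ ∂(gibbs π (4 * β) (empRisk f ω))) = V1 at *
  generalize (∫ θ, empRisk f ω θ ∂(gibbs π (γ / 2) (empRisk f ω))) = V2 at *
  generalize empRisk f ω θt = r0 at *
  obtain ⟨q', hq'⟩ : ∃ q', q' = q + 2 * D := ⟨_, rfl⟩
  rw [← hq'] at hK hK' hsmall
  -- Here `b = 4β`, so `γK ≤ 16βq'`, which `hsmall` compares with `pγ`.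
  have hKp : K ≤ 16 / 1000 * p := by
    by_contra! h
    have := mul_lt_mul_of_pos_left h hγ
    linarith
  have hK2 : K' ≤ 2 * q' := by
    by_contra! h
    have := mul_lt_mul_of_pos_left h hγ
    linarith
  have hU1 : 121 * q' ≤ γ * U1 := by
    have h1 : 484 / 1000 * p ≤ 4 * β * U1 := by linarith
    by_contra! h
    have h2 := mul_lt_mul_of_pos_left h hβ
    have h3 := mul_le_mul_of_nonneg_left h1 hγ.le
    linarith
  have hV1 : 104 * q' ≤ γ * (V1 - r0) := by
    have h1 := mul_le_mul_of_nonneg_right hβγ hU0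
    have h2 := (abs_le.1 hKv).1
    linarith
  have hU2 : γ * U2 ≤ 12 * q' := by linarith
  have hV2 : γ * (V2 - r0) ≤ 16 * q' := by
    have h1 := mul_le_mul_of_nonneg_right hβγ hU0'
    have h2 := (abs_le.1 hKv').2
    linarith
  constructor
  -- The drop contributes at most `(16 - 104)/2 = -44` units of `q'`, while `L1` and `L2` are at
  -- most 4 units each and `-l` at most one half.
  · linarith
  · by_contra! h
    have h2 := mul_lt_mul_of_pos_left h hγ
    have h3 := mul_le_mul_of_nonneg_left hU2 hβ.le
    have h4 : 0 ≤ β * q' := mul_nonneg hβ.le (by linarith)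
    linarith

end Deterministic

/-! ### Numerical conditions, margin function and the event. -/

section Final

/-- The numerical content of the conditions on `β` and `γ`. -/
theorem temperature_conditions {N : ℕ} {α β γ x φ d δ ε : ℝ} (hα : 1 < α) (hN : 0 < N)
    (hβ : β ∈ grid N α) (hγ : γ ∈ grid N α) (hd : 0 < d) (hδ : 0 < δ) (hδ1 : δ < 1) (hε : 0 < ε)
    (hε1 : ε ≤ 1) (hφ : 0 ≤ φ) (hT : 1 ≤ Real.log N / Real.log α)
    (h1 : γ * max x 1 / N ≤ 1 / 3 * β / γ)
    (h2 : β / γ ≤ 1 / 1000 / (1 * ((1 + δ) / (1 - δ)) +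
      (6 * (γ ^ 2 / N) * φ - 2 * 4 * Real.log ε + 4 * 4 * Real.log (Real.log N / Real.log α))
        / ((1 - δ) * d))) :
    8 * β ≤ γ ∧ γ / N ≤ 1 / 2 ∧ 3 * (γ ^ 2 / N) * x ≤ β ∧ 2 ≤ Real.log N / Real.log α ∧
      1000 * β * ((1 + δ) * d + 2 * (3 * (γ ^ 2 / N) * φ
        + (7 * Real.log (Real.log N / Real.log α) - Real.log ε))) ≤ (1 - δ) * d * γ := by
  have hN' : (0 : ℝ) < N := by exact_mod_cast hN
  have hβ1 := one_le_of_mem_grid hα hβ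
  have hγ1 := one_le_of_mem_grid hα hγ
  have hγ0 : 0 < γ := by linarith
  have hlogε : Real.log ε ≤ 0 := Real.log_nonpos hε.le hε1
  have hlogT : 0 ≤ Real.log (Real.log N / Real.log α) := Real.log_nonneg hT
  set T := Real.log (Real.log N / Real.log α)
  have hp : 0 < (1 - δ) * d := mul_pos (by linarith) hd
  have hq : (1 - δ) * d ≤ (1 + δ) * d := mul_le_mul_of_nonneg_right (by linarith) hd.le
  have hG : 0 ≤ γ ^ 2 / N * φ := by positivity
  set S := 6 * (γ ^ 2 / N) * φ - 2 * 4 * Real.log ε + 4 * 4 * T with hS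
  have hS0 : 0 ≤ S := by rw [hS]; linarith
  have e1 : 1 * ((1 + δ) / (1 - δ)) + S / ((1 - δ) * d) = ((1 + δ) * d + S) / ((1 - δ) * d) := by
    have : 1 - δ ≠ 0 := by linarith
    field_simp
  have hqS : 0 < (1 + δ) * d + S := by linarith
  rw [e1, div_div_eq_mul_div, div_le_div_iff₀ hγ0 hqS] at h2
  -- The denominator in `h2` is at least 1, because `(1 + δ)d + S ≥ (1 - δ)d`.
  have h8 : 1000 * β ≤ γ := by
    by_contra! h
    have h3 := mul_lt_mul_of_pos_left h hp
    have h4 := mul_le_mul_of_nonneg_left (show (1 - δ) * d ≤ (1 + δ) * d + S by linarith)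
      (show 0 ≤ β by linarith)
    linarith
  have hmax : γ ^ 2 * max x 1 ≤ 1 / 3 * β * N := by
    rw [div_le_div_iff₀ hN' hγ0] at h1
    linarith
  have hγ2 : γ ^ 2 ≤ 1 / 3 * β * N := by
    have := mul_le_mul_of_nonneg_left (le_max_right x 1) (sq_nonneg γ)
    linarith
  refine ⟨by linarith, ?_, ?_, ?_, ?_⟩
  · rw [div_le_iff₀ hN']
    have : γ * γ ≤ γ * (1 / 3000 * N) := by
      have := mul_le_mul_of_nonneg_right h8 hN'.le
      linarith
    have := le_of_mul_le_mul_left this hγ0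
    linarith
  · have h3 : γ ^ 2 * x ≤ 1 / 3 * β * N :=
      (mul_le_mul_of_nonneg_left (le_max_left x 1) (sq_nonneg γ)).trans hmax
    have e : 3 * (γ ^ 2 / N) * x = 3 * (γ ^ 2 * x) / N := by ring
    rw [e, div_le_iff₀ hN']
    linarith
  · have h3 := mul_le_of_mem_grid hα hβ hγ (by linarith)
    -- Distinct grid points differ by a factor at least `α`, so `α²β² ≤ γ² ≤ βN/3`, and `β ≥ 1`.
    have h4 : α ^ 2 ≤ N := by
      have h5 : (α * β) ^ 2 ≤ γ ^ 2 := pow_le_pow_left₀ (by positivity) h3 2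
      have h6 : β * α ^ 2 ≤ β * N := by
        have h7 : 0 ≤ (β - 1) * (β * α ^ 2) := mul_nonneg (by linarith) (by positivity)
        have h9 : 0 ≤ β * N := by positivity
        linarith
      exact le_of_mul_le_mul_left h6 (by linarith)
    rw [le_div_iff₀ (Real.log_pos hα)]
    have h5 := Real.log_le_log (by positivity) h4
    rwa [Real.log_pow, Nat.cast_ofNat] at h5
  · have h3 : 2 * (3 * (γ ^ 2 / N) * φ + (7 * T - Real.log ε)) ≤ S := by rw [hS]; linarith
    have h4 := mul_le_mul_of_nonneg_left h3 (show 0 ≤ β by linarith)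
    linarith

/-- For `t ≥ 2` both `t + 1 ≤ t²` and `6 ≤ t³`: the rounding in the grid size and the union bound
cost only multiples of `log t`. -/
theorem log_card_le {n : ℕ} {t : ℝ} (ht : 2 ≤ t) (hn0 : 0 < n) (hn : (n : ℝ) ≤ t + 1) :
    2 * Real.log n ≤ 4 * Real.log t ∧ Real.log (n * n * 6) ≤ 7 * Real.log t := by
  have hn' : (0 : ℝ) < n := by exact_mod_cast hn0
  have h1 : Real.log n ≤ 2 * Real.log t := by
    rw [← Nat.cast_ofNat, ← Real.log_pow]
    exact Real.log_le_log hn' (by nlinarith)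
  have h2 : Real.log 6 ≤ 3 * Real.log t := by
    have : (6 : ℝ) ≤ t ^ 3 := by
      have := pow_le_pow_left₀ (by norm_num) ht 3
      linarith
    have h := Real.log_le_log (by norm_num) this
    rwa [Real.log_pow, Nat.cast_ofNat] at h
  rw [Real.log_mul (by positivity) (by norm_num), Real.log_mul hn'.ne' hn'.ne']
  constructor <;> linarith

variable {X Y Θ : Type*} [MeasurableSpace X] [Finite Y] [MeasurableSpace Y]
  [DiscreteMeasurableSpace Y] [MeasurableSpace Θ] {N : ℕ} {P : Fin N → Measure (X × Y)}
  [∀ i, IsProbabilityMeasure (P i)] {f : Θ → X → Y}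

theorem bddAbove_margin (hf : Measurable (fun p : Θ × X => f p.1 p.2)) (θt : Θ) (x : ℝ) :
    BddAbove (Set.range fun θ => expDist P f θ θt - x * (risk P f θ - risk P f θt)) := by
  obtain ⟨-, C, hC⟩ := (bddMeas_expDist (P := P) hf θt).sub
    (((bddMeas_risk (P := P) hf).sub (BddMeas.const (risk P f θt))).const_mul x)
  refine ⟨C, ?_⟩
  rintro _ ⟨θ, rfl⟩
  exact (le_abs_self _).trans (hC θ)

theorem expDist_le_margin (hf : Measurable (fun p : Θ × X => f p.1 p.2)) (θ θt : Θ) (x : ℝ) :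
    expDist P f θ θt ≤ x * (risk P f θ - risk P f θt) + margin P f θt x := by
  have := le_ciSup (bddAbove_margin (P := P) hf θt x) θ
  unfold margin
  linarith

theorem margin_nonneg (hf : Measurable (fun p : Θ × X => f p.1 p.2)) (θt : Θ) (x : ℝ) :
    0 ≤ margin P f θt x := by
  have h := expDist_le_margin (P := P) hf θt θt x
  have h0 : 0 ≤ expDist P f θt θt :=
    mul_nonneg (by positivity) (Finset.sum_nonneg fun _ _ => integral_nonneg fun _ => sq_nonneg _)
  linarith

/-- Replacing the distance term of the deviations by the margin function. -/
theorem logMgf_le_of_deviation (hf : Measurable (fun p : Θ × X => f p.1 p.2)) (θt : Θ)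
    (π : Measure Θ) [IsProbabilityMeasure π] (ω : Fin N → X × Y)
    (hθt : ∀ θ, risk P f θt ≤ risk P f θ) {b t c g β x D : ℝ}
    (hx : 3 * (g ^ 2 / N) * x ≤ β)
    (H : logMgf (gibbs π b (risk P f)) (deviation P f θt t c g ω) ≤ D) :
    logMgf (gibbs π b (fun θ => risk P f θ - risk P f θt))
      (fun θ => t * (empRisk f ω θ - empRisk f ω θt - (risk P f θ - risk P f θt))
        + c * empDist f ω θ θt - β * (risk P f θ - risk P f θt))
      ≤ 3 * (g ^ 2 / N) * margin P f θt x + D := by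
  have := isProbabilityMeasure_gibbs (Q := π) (bddMeas_risk (P := P) hf) b
  have hu := (bddMeas_risk (P := P) hf).sub (BddMeas.const (risk P f θt))
  have hv := (bddMeas_empRisk hf ω).sub (BddMeas.const (empRisk f ω θt))
  have hd := bddMeas_deviation (P := P) hf θt t c g ω
  rw [gibbs_sub_const]
  have h := logMgf_mono (Q := gibbs π b (risk P f))
    ((((hv.sub hu).const_mul t).add ((bddMeas_empDist hf ω θt).const_mul c)).sub (hu.const_mul β))
    (hd.add (BddMeas.const (3 * (g ^ 2 / N) * margin P f θt x))) (fun θ => by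
      have h1 := mul_le_mul_of_nonneg_left (expDist_le_margin (P := P) hf θ θt x)
        (show 0 ≤ 3 * (g ^ 2 / N) by positivity)
      have h2 := mul_le_mul_of_nonneg_right hx (sub_nonneg.2 (hθt θ))
      unfold deviation
      linarith)
  rw [logMgf_add_const hd] at h
  linarith

/-- The exponential inequalities used at the pair `(β, γ)`, at all pairs simultaneously. -/
theorem exists_event_grid (hf : Measurable (fun p : Θ × X => f p.1 p.2)) (θt : Θ) (hN : 0 < N)
    (π : Measure Θ) [IsProbabilityMeasure π] (S : Finset ℝ) {ε : ℝ} (hε : 0 < ε) :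
    ∃ E : Set (Fin N → X × Y), MeasurableSet E ∧ ENNReal.ofReal (1 - ε) ≤ Measure.pi P E ∧
      ∀ ω ∈ E, ∀ β ∈ S, ∀ γ ∈ S, 0 < β → 8 * β ≤ γ → γ ≤ N / 2 →
        ∀ b, b = 4 * β ∨ b = γ / 2 →
        logMgf (gibbs π b (risk P f)) (deviation P f θt (-γ) 0 γ ω)
          ≤ Real.log (S.card * S.card * 6 / ε) ∧
        logMgf (gibbs π b (risk P f)) (deviation P f θt γ 0 γ ω)
          ≤ Real.log (S.card * S.card * 6 / ε) ∧
        logMgf (gibbs π (b / 2) (risk P f)) (deviation P f θt (-b) (γ ^ 2 / (2 * N)) γ ω)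
          ≤ Real.log (S.card * S.card * 6 / ε) := by
  classical
  -- The Boolean selects the inverse temperature `4β` or `γ/2`, and `Fin 3` one of the three
  -- inequalities; hence the factor 6.
  set J : Finset ((ℝ × ℝ) × Bool × Fin 3) :=
    ((S ×ˢ S) ×ˢ Finset.univ).filter
      (fun i => 0 < i.1.1 ∧ 8 * i.1.1 ≤ i.1.2 ∧ i.1.2 ≤ N / 2) with hJ
  have hJc : (J.card : ℝ) ≤ S.card * S.card * 6 := by
    have : J.card ≤ S.card * S.card * 6 := by
      refine (Finset.card_filter_le _ _).trans (le_of_eq ?_)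
      simp [Finset.card_product]
    exact_mod_cast this
  obtain ⟨E, hE, hPE, H⟩ := exists_event_deviation (P := P) hf θt hN π J
    (fun i => ![(if i.2.1 then 4 * i.1.1 else i.1.2 / 2), (if i.2.1 then 4 * i.1.1 else i.1.2 / 2),
      (if i.2.1 then 4 * i.1.1 else i.1.2 / 2) / 2] i.2.2)
    (fun i => ![-i.1.2, i.1.2, -(if i.2.1 then 4 * i.1.1 else i.1.2 / 2)] i.2.2)
    (fun i => ![0, 0, i.1.2 ^ 2 / (2 * N)] i.2.2) (fun i => i.1.2)
    (by
      rintro ⟨⟨β, γ⟩, s, k⟩ hi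
      obtain ⟨-, h1, h2, h3⟩ := Finset.mem_filter.1 hi
      dsimp only at h1 h2 h3
      have hc : 0 ≤ γ ^ 2 / (2 * (N : ℝ)) := by positivity
      have hγ : 0 < γ := by linarith
      refine ⟨?_, h3, ?_, ?_⟩
      · fin_cases k
        · simp [abs_of_pos hγ]
        · simp [abs_of_pos hγ]
        · cases s
          · simp only [Fin.reduceFinMk, Matrix.cons_val, abs_neg]
            rw [if_neg (by simp), abs_of_pos (by linarith)]
            linarith
          · simp only [Fin.reduceFinMk, Matrix.cons_val, abs_neg]
            rw [if_pos trivial, abs_of_pos (by linarith)]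
            linarith
      · fin_cases k <;> simp [hc]
      · fin_cases k <;> simp [hc])
    hε
  refine ⟨E, hE, hPE, fun ω hω β hβ γ hγ h1 h2 h3 b hb => ?_⟩
  have key : ∀ s k, ((β, γ), s, k) ∈ J := fun s k =>
    Finset.mem_filter.2 ⟨by simp [hβ, hγ], h1, h2, h3⟩
  have hlog : Real.log (J.card / ε) ≤ Real.log (S.card * S.card * 6 / ε) := by
    have : (0 : ℝ) < J.card := by exact_mod_cast Finset.card_pos.2 ⟨_, key true 0⟩
    exact Real.log_le_log (by positivity) (by gcongr)
  obtain ⟨s, rfl⟩ : ∃ s : Bool, b = if s then 4 * β else γ / 2 := by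
    rcases hb with rfl | rfl
    · exact ⟨true, by simp⟩
    · exact ⟨false, by simp⟩
  exact ⟨(H ω hω _ (key s 0)).trans hlog, (H ω hω _ (key s 1)).trans hlog,
    (H ω hω _ (key s 2)).trans hlog⟩

end Final

end PACBayes

theorem mainTheorem3 :
    ∃ A B₁ B₂ B₃ B₄ : ℝ, 0 < A ∧ 0 < B₁ ∧ 0 < B₂ ∧ 0 < B₃ ∧ 0 < B₄ ∧
      ∀ (X : Type*) [MeasurableSpace X]
        (Y : Type*) [Finite Y] [MeasurableSpace Y] [DiscreteMeasurableSpace Y]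
        (Θ : Type*) [MeasurableSpace Θ]
        (N : ℕ) (P : Fin N → Measure (X × Y)) [∀ i, IsProbabilityMeasure (P i)]
        (f : Θ → X → Y) (_ : Measurable (fun p : Θ × X => f p.1 p.2))
        (θt : Θ) (_ : ∀ θ, PACBayes.risk P f θt ≤ PACBayes.risk P f θ)
        (α d δ ε : ℝ) (_ : 1 < α) (_ : α ≤ N) (_ : 0 < d) (_ : 0 < δ) (_ : δ < 1)
        (_ : 0 < ε) (_ : ε ≤ 1)
        (π : Measure Θ) [IsProbabilityMeasure π],
        ∃ E : Set (Fin N → X × Y), MeasurableSet E ∧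
          ENNReal.ofReal (1 - ε) ≤ Measure.pi P E ∧
          ∀ ω ∈ E, ∀ β ∈ PACBayes.grid N α, ∀ γ ∈ PACBayes.grid N α,
            (∀ β' : ℝ, β ≤ β' →
              |β' / d * (∫ θ, PACBayes.risk P f θ ∂(PACBayes.gibbs π β' (PACBayes.risk P f))
                - ⨅ θ, PACBayes.risk P f θ) - 1| ≤ δ) →
            (∃ x : ℝ, 0 < x ∧
              γ * max x 1 / N ≤ A * β / γ ∧
              β / γ ≤ B₁ / (B₂ * ((1 + δ) / (1 - δ)) +
                (B₄ * (γ ^ 2 / N) * PACBayes.margin P f θt x - 2 * B₃ * Real.log ε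
                  + 4 * B₃ * Real.log (Real.log N / Real.log α)) / ((1 - δ) * d))) →
            PACBayes.bound f π (ProbabilityTheory.uniformOn (PACBayes.grid N α)) ε ω
                (PACBayes.gibbs π (γ / 2) (PACBayes.empRisk f ω)) β γ ≤ 0 ∧
            (β : EReal) ≤ PACBayes.betaHat f π
                (ProbabilityTheory.uniformOn (PACBayes.grid N α)) ε ω
                (PACBayes.gibbs π (γ / 2) (PACBayes.empRisk f ω)) ∧
            ∫ θ, PACBayes.risk P f θ ∂(PACBayes.gibbs π (γ / 2) (PACBayes.empRisk f ω))
              ≤ ∫ θ, PACBayes.risk P f θ ∂(PACBayes.gibbs π β (PACBayes.risk P f)) ∧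
            ∫ θ, PACBayes.risk P f θ ∂(PACBayes.gibbs π β (PACBayes.risk P f))
              ≤ (⨅ θ, PACBayes.risk P f θ) + (1 + δ) * d / β := by
  -- `1/3` offsets the 3 in `deviation`; `1/1000` is the slack of `hsmall`; 6 is twice that 3; and 4
  -- ensures that `4·4` covers the `2·7` multiplying `log(log N / log α)`.
  refine ⟨1 / 3, 1 / 1000, 1, 4, 6, by norm_num, by norm_num, by norm_num, by norm_num,
    by norm_num, ?_⟩
  intro X _ Y _ _ _ Θ _ N P _ f hf θt hθt α d δ ε hα hαN hd hδ hδ1 hε hε1 π _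
  have hN' : (0 : ℝ) < N := by linarith
  have hN : 0 < N := by exact_mod_cast hN'
  have hfin := PACBayes.grid_finite N α
  have hlogα := Real.log_pos hα
  have hT : 1 ≤ Real.log N / Real.log α := by
    rw [le_div_iff₀ hlogα, one_mul]
    exact Real.log_le_log (by linarith) hαN
  obtain ⟨E, hE, hPE, H⟩ := PACBayes.exists_event_grid (P := P) hf θt hN π hfin.toFinset hε
  refine ⟨E, hE, hPE, ?_⟩
  rintro ω hω β hβ γ hγ hdim ⟨x, -, h1, h2⟩
  obtain ⟨hβγ, hγN, hx, hT2, hsmall⟩ := PACBayes.temperature_conditions hα hN hβ hγ hd hδ hδ1 hε hε1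
    (PACBayes.margin_nonneg (P := P) hf θt x) hT h1 h2
  set n := (PACBayes.grid N α).ncard with hn
  have hcard : hfin.toFinset.card = n := (Set.ncard_eq_toFinset_card _ hfin).symm
  have hn0 : 0 < n := (Set.ncard_pos hfin).2 ⟨β, hβ⟩
  have hn' : (0 : ℝ) < n := by exact_mod_cast hn0
  obtain ⟨hl1, hl2⟩ := PACBayes.log_card_le hT2 hn0 (PACBayes.ncard_grid_le (by linarith))
  have hβ0 : 0 < β := by linarith [PACBayes.one_le_of_mem_grid hα hβ]
  have hγ0 : 0 < γ := by linarith
  have hinf : ⨅ θ, PACBayes.risk P f θ = PACBayes.risk P f θt := by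
    have : Nonempty Θ := ⟨θt⟩
    exact le_antisymm (ciInf_le ⟨PACBayes.risk P f θt, by rintro _ ⟨θ, rfl⟩; exact hθt θ⟩ θt)
      (le_ciInf hθt)
  rw [hinf] at hdim ⊢
  have hR := PACBayes.bddMeas_risk (P := P) hf
  set u : Θ → ℝ := fun θ => PACBayes.risk P f θ - PACBayes.risk P f θt with hu_def
  have hu : PACBayes.BddMeas u := hR.sub (PACBayes.BddMeas.const _)
  have hint : ∀ (ρ : Measure Θ) [IsProbabilityMeasure ρ],
      ∫ θ, u θ ∂ρ = ∫ θ, PACBayes.risk P f θ ∂ρ - PACBayes.risk P f θt := by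
    intro ρ _
    rw [hu_def, integral_sub hR.integrable (integrable_const _)]
    simp
  have hgu : ∀ b, PACBayes.gibbs π b u = PACBayes.gibbs π b (PACBayes.risk P f) := fun b =>
    PACBayes.gibbs_sub_const b _
  have hpq : ∀ b', β ≤ b' → (1 - δ) * d ≤ b' * ∫ θ, u θ ∂(PACBayes.gibbs π b' u) ∧
      b' * ∫ θ, u θ ∂(PACBayes.gibbs π b' u) ≤ (1 + δ) * d := by
    intro b' hb'
    have := PACBayes.isProbabilityMeasure_gibbs (Q := π) hR b'
    rw [hgu, hint]
    obtain ⟨a1, a2⟩ := abs_le.1 (hdim b' hb')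
    rw [div_mul_eq_mul_div] at a1 a2
    constructor
    · rw [← le_div_iff₀ hd]
      linarith
    · rw [← div_le_iff₀ hd]
      linarith
  have hlogε : Real.log ε ≤ 0 := Real.log_nonpos hε.le hε1
  have hφ : 0 ≤ 3 * (γ ^ 2 / N) * PACBayes.margin P f θt x :=
    mul_nonneg (by positivity) (PACBayes.margin_nonneg hf θt x)
  have hνb : ∀ b ∈ PACBayes.grid N α,
      (ProbabilityTheory.uniformOn (PACBayes.grid N α)).real {b} = (n : ℝ)⁻¹ := fun b hb => by
    rw [measureReal_def, PACBayes.uniformOn_grid_singleton hb]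
    simp [hn]
  have hlog : Real.log (ε * (n : ℝ)⁻¹ * (n : ℝ)⁻¹) = Real.log ε - 2 * Real.log n := by
    rw [Real.log_mul (by positivity) (by positivity), Real.log_mul hε.ne' (by positivity),
      Real.log_inv]
    ring
  have hlogn : 0 ≤ Real.log n := Real.log_nonneg (by exact_mod_cast hn0)
  have hγN2 : γ ≤ N / 2 := by
    rw [div_le_iff₀ hN'] at hγN
    linarith
  obtain ⟨hB, hU⟩ := PACBayes.bound_expression_nonpos hf θt hN π ω hu
    (fun θ => sub_nonneg.2 (hθt θ)) hβ0 hβγ hγN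
    (D := 3 * (γ ^ 2 / N) * PACBayes.margin P f θt x
      + (7 * Real.log (Real.log N / Real.log α) - Real.log ε))
    (l := Real.log (ε * (n : ℝ)⁻¹ * (n : ℝ)⁻¹))
    (by rw [hlog]; linarith) (by rw [hlog]; linarith [Real.log_nonneg hT])
    (mul_pos (by linarith) hd)
    (fun b' hb' => (hpq b' hb').1) (fun b' hb' => (hpq b' hb').2) hsmall
    (by
      intro b hb
      obtain ⟨b1, b2, b3⟩ := H ω hω β (hfin.mem_toFinset.2 hβ) γ (hfin.mem_toFinset.2 hγ) hβ0 hβγ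
        hγN2 b hb
      have hc : Real.log (hfin.toFinset.card * hfin.toFinset.card * 6 / ε)
          ≤ 7 * Real.log (Real.log N / Real.log α) - Real.log ε := by
        rw [hcard, Real.log_div (by positivity) hε.ne']
        linarith
      have c1 := PACBayes.logMgf_le_of_deviation hf θt π ω hθt hx (b1.trans hc)
      have c2 := PACBayes.logMgf_le_of_deviation hf θt π ω hθt hx (b2.trans hc)
      have c3 := PACBayes.logMgf_le_of_deviation hf θt π ω hθt hx (b3.trans hc)
      simp only [zero_mul, add_zero] at c1 c2
      exact ⟨c1, c2, c3⟩)
  have htanh : γ / 2 ≤ N * Real.tanh (γ / N) := by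
    have ht := PACBayes.half_le_tanh (s := γ / N) (by positivity) hγN
    have := mul_le_mul_of_nonneg_left ht hN'.le
    have e2 : (N : ℝ) * (γ / N / 2) = γ / 2 := by field_simp
    linarith
  have hbound : PACBayes.bound f π (ProbabilityTheory.uniformOn (PACBayes.grid N α)) ε ω
      (PACBayes.gibbs π (γ / 2) (PACBayes.empRisk f ω)) β γ ≤ 0 := by
    have hr := PACBayes.isProbabilityMeasure_gibbs (Q := π) (PACBayes.bddMeas_empRisk hf ω) (γ / 2)
    rw [PACBayes.bound, if_neg (by
      rw [PACBayes.uniformOn_grid_singleton hβ, PACBayes.uniformOn_grid_singleton hγ]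
      simp), hνb β hβ, hνb γ hγ]
    -- `4β` is admissible because `N tanh(γ/N) ≥ γ/2` makes the threshold at most `2β`.
    refine iInf_le_of_le (γ / 2) (iInf_le_of_le (4 * β) (iInf_le_of_le ⟨by positivity, by linarith,
      ?_⟩ ?_))
    · have h0 : 0 < Real.tanh (γ / N) := by
        by_contra! h
        have := mul_nonneg hN'.le (neg_nonneg.2 h)
        linarith
      rw [← div_eq_mul_inv, div_div, div_lt_iff₀ (by positivity)]
      have := mul_le_mul_of_nonneg_left htanh hβ0.le
      have := mul_pos hβ0 hγ0
      linarith
    · rw [InformationTheory.klDiv_self, EReal.coe_ennreal_zero, zero_add]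
      exact_mod_cast hB
  refine ⟨hbound, ?_, ?_, ?_⟩
  -- The same `γ` serves in the infimum, since `β ≤ γ/8 < γ/2 ≤ N tanh(γ/N)`.
  · exact le_iSup₂_of_le β (iInf₂_le_of_le γ (by linarith) hbound) le_rfl
  · have i1 := PACBayes.isProbabilityMeasure_gibbs (Q := π) (PACBayes.bddMeas_empRisk hf ω) (γ / 2)
    have i2 := PACBayes.isProbabilityMeasure_gibbs (Q := π) hR β
    have h3 := (hpq β le_rfl).1
    rw [hgu] at h3
    have h4 := le_of_mul_le_mul_left (hU.trans h3) hβ0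
    rw [hint, hint] at h4
    linarith
  · have i2 := PACBayes.isProbabilityMeasure_gibbs (Q := π) hR β
    have h3 := (hpq β le_rfl).2
    rw [hgu, hint] at h3
    rw [← sub_le_iff_le_add', le_div_iff₀ hβ0]
    linarith
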